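/- Let $\Gamma$ be a group. For a finite abelian group $S$, let $\Sigma(\Gamma,S)$ be the Bernoulli shift, i.e. the compact abelian group of all functions $\tau:\Gamma\to S$ with the product topology ($S$ discrete) and the action $(\gamma\cdot\tau)(\gamma')=\tau(\gamma'\gamma)$ of $\Gamma$. A linear subshift is a closed $\Gamma$-invariant subgroup of some $\Sigma(\Gamma,S)$. The group $\Gamma$ is called SEA (symbolically entropy additive) if: (A1) there is a real-valued function $h$ on the linear subshifts (over all finite abelian groups $S$) such that (A2) $h(\Sigma(\Gamma,S))=\log_2|S|$ for every finite abelian group $S$; (A3) if $\phi_1\subset\phi_2\subset\Sigma(\Gamma,S)$ are linear subshifts, then $0\le h(\phi_1)\le h(\phi_2)$; (A4) if $\phi_1\subset\Sigma(\Gamma,S_1)$ and $\phi_2\subset\Sigma(\Gamma,S_2)$ are linear subshifts and there is a $\Gamma$-equivariant homeomorphism $\phi_1\to\phi_2$, then $h(\phi_1)=h(\phi_2)$; (A5) if a linear subshift $\phi$ has only finitely many elements, then $h(\phi)=0$; (A6) (Yuzvinskii axiom) if $T:\phi_1\to\phi_2$ is a surjective continuous $\Gamma$-equivariant group homomorphism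 between linear subshifts, then $h(\ker T)+h(\phi_2)=h(\phi_1)$. The group $\Gamma$ is of finite type if it has a finite simplicial classifying space, i.e. a finite simplicial complex $B\Gamma$ with fundamental group $\Gamma$ (so that $\Gamma$ is the deck transformation group of its universal cover $E\Gamma$) such that $E\Gamma$ is contractible. The homotopy type of $B\Gamma$ depends only on $\Gamma$, and $e(\Gamma)=\chi(B\Gamma)=\sum_{\sigma}(-1)^{\dim\sigma}$, the sum over the simplices $\sigma$ of $B\Gamma$, is the Euler characteristic of $\Gamma$. **Theorem.** If $\Gamma$ is a group of finite type and $e(\Gamma)\neq 0$ (that is, $\chi(B\Gamma)\ne0$ for some finite simplicial classifying space $B\Gamma$ of $\Gamma$), then $\Gamma$ is not SEA. -/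

import Mathlib

open Topology

/-! ### Bernoulli shifts and linear subshifts -/

/-- The Bernoulli shift `Σ(Γ, S)`: the group of all `S`-valued functions on `Γ`. -/
def BernoulliShift (Γ S : Type*) : Type _ := Γ → S

namespace BernoulliShift

instance (Γ S : Type*) [AddCommGroup S] : AddCommGroup (BernoulliShift Γ S) :=
  inferInstanceAs (AddCommGroup (Γ → S))

/-- The product topology, where each factor `S` is discrete. -/
instance (Γ S : Type*) : TopologicalSpace (BernoulliShift Γ S) :=
  @Pi.topologicalSpace Γ (fun _ => S) (fun _ => ⊥)

instance (Γ S : Type*) : T2Space (BernoulliShift Γ S) :=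
  letI : TopologicalSpace S := ⊥
  haveI : DiscreteTopology S := ⟨rfl⟩
  inferInstanceAs (T2Space (Γ → S))

/-- The left action `(γ • τ)(γ') = τ(γ' γ)`. -/
instance (Γ S : Type*) [Monoid Γ] : MulAction Γ (BernoulliShift Γ S) where
  smul γ τ := fun γ' => τ (γ' * γ)
  one_smul τ := funext fun γ' => congrArg τ (mul_one γ')
  mul_smul a b τ := funext fun γ' => congrArg τ (mul_assoc γ' a b).symm

theorem smul_apply {Γ S : Type*} [Monoid Γ] (γ γ' : Γ) (τ : BernoulliShift Γ S) :
    (γ • τ) γ' = τ (γ' * γ) := rfl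

theorem smul_zero {Γ S : Type*} [Monoid Γ] [AddCommGroup S] (γ : Γ) :
    γ • (0 : BernoulliShift Γ S) = 0 := rfl

end BernoulliShift

/-- A linear subshift: a closed `Γ`-invariant subgroup of the Bernoulli shift `Σ(Γ, S)`. -/
structure LinearSubshift (Γ S : Type*) [Monoid Γ] [AddCommGroup S] where
  /-- the underlying subgroup -/
  toAddSubgroup : AddSubgroup (BernoulliShift Γ S)
  isClosed : IsClosed (toAddSubgroup : Set (BernoulliShift Γ S))
  smul_mem : ∀ (γ : Γ) {τ : BernoulliShift Γ S}, τ ∈ toAddSubgroup → γ • τ ∈ toAddSubgroup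

namespace LinearSubshift

/-- The points of a linear subshift, as a topological group with the topology induced from the
Bernoulli shift. -/
abbrev Points {Γ S : Type*} [Monoid Γ] [AddCommGroup S] (φ : LinearSubshift Γ S) : Type _ :=
  φ.toAddSubgroup

instance {Γ S : Type*} [Monoid Γ] [AddCommGroup S] (φ : LinearSubshift Γ S) :
    MulAction Γ φ.Points where
  smul γ τ := ⟨γ • (τ : BernoulliShift Γ S), φ.smul_mem γ τ.2⟩
  one_smul τ := Subtype.ext (one_smul Γ (τ : BernoulliShift Γ S))
  mul_smul a b τ := Subtype.ext (mul_smul a b (τ : BernoulliShift Γ S))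

theorem coe_smul {Γ S : Type*} [Monoid Γ] [AddCommGroup S] (φ : LinearSubshift Γ S) (γ : Γ)
    (τ : φ.Points) : ((γ • τ : φ.Points) : BernoulliShift Γ S) = γ • (τ : BernoulliShift Γ S) :=
  rfl

/-- The full Bernoulli shift as a linear subshift of itself. -/
def full (Γ S : Type*) [Monoid Γ] [AddCommGroup S] : LinearSubshift Γ S where
  toAddSubgroup := ⊤
  isClosed := isClosed_univ
  smul_mem _ _ _ := trivial

/-- The kernel of a continuous equivariant homomorphism `T : φ₁ → φ₂` of linear subshifts; it is a
linear subshift of the Bernoulli shift containing `φ₁`. -/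
def ker {Γ S₁ S₂ : Type*} [Monoid Γ] [AddCommGroup S₁] [AddCommGroup S₂]
    {φ₁ : LinearSubshift Γ S₁} {φ₂ : LinearSubshift Γ S₂} (T : φ₁.Points →+ φ₂.Points)
    (hT : Continuous T) (hequiv : ∀ (γ : Γ) (τ : φ₁.Points), T (γ • τ) = γ • T τ) :
    LinearSubshift Γ S₁ where
  toAddSubgroup := T.ker.map φ₁.toAddSubgroup.subtype
  isClosed := by
    have h : IsClosed (T ⁻¹' {0}) := isClosed_singleton.preimage hT
    exact φ₁.isClosed.isClosedEmbedding_subtypeVal.isClosedMap _ h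
  smul_mem := by
    rintro γ _ ⟨τ, hτ, rfl⟩
    refine ⟨γ • τ, ?_, rfl⟩
    have h0 : T τ = 0 := hτ
    change T (γ • τ) = 0
    rw [hequiv, h0]
    exact Subtype.ext (BernoulliShift.smul_zero γ)

end LinearSubshift

/-! ### Symbolically entropy additive groups -/

/-- A real-valued function on all linear subshifts over `Γ` (with arbitrary finite abelian
alphabet) satisfying the axioms of an entropy that obeys the addition formula. -/
structure AdditiveEntropy (Γ : Type*) [Monoid Γ] where
  /-- (A1) the entropy function -/
  h : ∀ {S : Type} [AddCommGroup S] [Finite S], LinearSubshift Γ S → ℝ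
  /-- (A2) -/
  h_full : ∀ (S : Type) [AddCommGroup S] [Finite S],
    h (LinearSubshift.full Γ S) = Real.logb 2 (Nat.card S)
  /-- (A3) -/
  h_mono : ∀ {S : Type} [AddCommGroup S] [Finite S] (φ₁ φ₂ : LinearSubshift Γ S),
    φ₁.toAddSubgroup ≤ φ₂.toAddSubgroup → 0 ≤ h φ₁ ∧ h φ₁ ≤ h φ₂
  /-- (A4) invariance under topological conjugacy -/
  h_homeomorph : ∀ {S₁ S₂ : Type} [AddCommGroup S₁] [Finite S₁] [AddCommGroup S₂] [Finite S₂]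
    (φ₁ : LinearSubshift Γ S₁) (φ₂ : LinearSubshift Γ S₂) (T : φ₁.Points ≃ₜ φ₂.Points),
    (∀ (γ : Γ) (τ : φ₁.Points), T (γ • τ) = γ • T τ) → h φ₁ = h φ₂
  /-- (A5) -/
  h_finite : ∀ {S : Type} [AddCommGroup S] [Finite S] (φ : LinearSubshift Γ S),
    Finite φ.Points → h φ = 0
  /-- (A6) the Yuzvinskii axiom -/
  h_add : ∀ {S₁ S₂ : Type} [AddCommGroup S₁] [Finite S₁] [AddCommGroup S₂] [Finite S₂]
    (φ₁ : LinearSubshift Γ S₁) (φ₂ : LinearSubshift Γ S₂) (T : φ₁.Points →+ φ₂.Points)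
    (hT : Continuous T) (hequiv : ∀ (γ : Γ) (τ : φ₁.Points), T (γ • τ) = γ • T τ),
    Function.Surjective T → h (LinearSubshift.ker T hT hequiv) + h φ₂ = h φ₁

/-- `Γ` is symbolically entropy additive (SEA). -/
def IsSEA (Γ : Type*) [Monoid Γ] : Prop := Nonempty (AdditiveEntropy Γ)

/-! ### Groups of finite type -/

/-- A finite simplicial classifying space `BΓ` of a group `Γ`: a finite simplicial complex in some
Euclidean space whose universal cover `EΓ`, with deck transformation group `Γ`, is contractible. -/
structure FiniteClassifyingComplex (Γ : Type*) [Group Γ] where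
  /-- dimension of the ambient Euclidean space -/
  dim : ℕ
  /-- the simplicial complex -/
  complex : Geometry.SimplicialComplex ℝ (EuclideanSpace ℝ (Fin dim))
  finite_faces : complex.faces.Finite
  exists_contractible_cover : ∃ (E : Type) (_ : TopologicalSpace E) (_ : MulAction Γ E)
    (p : E → complex.space), ContractibleSpace E ∧ IsQuotientCoveringMap p Γ

namespace FiniteClassifyingComplex

/-- The Euler characteristic `χ(BΓ) = ∑ (-1)^(dim σ)`, over the simplices `σ` of `BΓ`; a simplex
with vertex set `s` has dimension `|s| - 1`, and `s` is nonempty. -/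
noncomputable def eulerChar {Γ : Type*} [Group Γ] (B : FiniteClassifyingComplex Γ) : ℤ :=
  ∑ s ∈ B.finite_faces.toFinset, (-1 : ℤ) ^ (s.card - 1)

/-- The fundamental group of `BΓ` is `Γ`. -/
theorem nonempty_fundamentalGroup_mulEquiv {Γ : Type*} [Group Γ] (B : FiniteClassifyingComplex Γ)
    (x : B.complex.space) : Nonempty (FundamentalGroup B.complex.space x ≃* Γ) := by
  obtain ⟨E, _, _, p, hE, hp⟩ := B.exists_contractible_cover
  obtain ⟨e, he⟩ := hp.surjective x
  exact ⟨(hp.fundamentalGroupEquiv ⟨e, he⟩).trans (MulEquiv.inv' Γ).symm⟩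

end FiniteClassifyingComplex

/-!
Let `X` be the triangulation of `EΓ` lifted from `BΓ`. As `Γ` acts freely on the simplices of `X`,
the mod 2 cochains of degree `n` form a Bernoulli shift whose alphabet is `(ℤ/2)^k`, with `k` the
number of `n`-simplices of `BΓ`, and the coboundary is continuous and equivariant. Since `EΓ` is
contractible, the image of the coboundary in degree `n` is the group `Zⁿ⁺¹` of cocycles, so the
Yuzvinskii axiom gives `h(Zⁿ) + h(Zⁿ⁺¹) = k`. As `Z⁰` is finite and `Zⁿ = 0` for large `n`, the
alternating sum of these equations telescopes to `χ(BΓ) = 0`.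

That a cycle of `X` bounds is shown without singular homology. Replace it by a fine subdivision,
a cycle of tuples of nearby points of `EΓ`, built simplex by simplex by the method of acyclic
carriers. Prism operators along a contraction of `EΓ` fill it by fine chains. As in simplicial
approximation, some vertex map, which sends each point to a vertex of every lifted simplex
containing it, turns the filling into a chain of `X` and the subdivision into the original cycle.
-/

/-! ### Mod 2 chains -/

/-- The mod 2 chains all of whose simplices lie in `A`. -/
abbrev chainsIn {α : Type*} (A : Set α) : Submodule (ZMod 2) (α →₀ ZMod 2) :=
  Finsupp.supported (ZMod 2) (ZMod 2) A

section SupportedMaps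

variable {α R M : Type*} [Semiring R] [AddCommMonoid M] [Module R M] {A : Set α} {c : α →₀ R}

theorem map_mem_of_mem_supported (f : (α →₀ R) →ₗ[R] M) {N : Submodule R M}
    (hf : ∀ a ∈ A, f (Finsupp.single a 1) ∈ N) (hc : c ∈ Finsupp.supported R R A) : f c ∈ N := by
  rw [Finsupp.supported_eq_span_single] at hc
  exact (Submodule.span_le (p := N.comap f)).2 (Set.forall_mem_image.2 hf) hc

theorem map_eq_map_of_mem_supported {f g : (α →₀ R) →ₗ[R] M}
    (hfg : ∀ a ∈ A, f (Finsupp.single a 1) = g (Finsupp.single a 1))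
    (hc : c ∈ Finsupp.supported R R A) : f c = g c := by
  rw [Finsupp.supported_eq_span_single] at hc
  exact LinearMap.eqOn_span (Set.forall_mem_image.2 hfg) hc

end SupportedMaps

/-- Mod 2 chains spanned by lists, i.e. by ordered, possibly degenerate simplices of all
dimensions, including the empty one. -/
abbrev ListChain (V : Type*) : Type _ := List V →₀ ZMod 2

/-- Mod 2 chains spanned by finite sets, i.e. by unordered simplices of all dimensions, including
the empty one. -/
abbrev SetChain (V : Type*) : Type _ := Finset V →₀ ZMod 2

namespace ListChain

variable {V W : Type*}

/-- The cone `l ↦ a :: l` with apex `a`. -/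
noncomputable def cone (a : V) : ListChain V →ₗ[ZMod 2] ListChain V :=
  Finsupp.lmapDomain _ _ (List.cons a)

@[simp] theorem cone_single (a : V) (l : List V) (r : ZMod 2) :
    cone a (Finsupp.single l r) = Finsupp.single (a :: l) r := by
  simp [cone]

theorem linearMap_ext {M : Type*} [AddCommGroup M] [Module (ZMod 2) M]
    {f g : ListChain V →ₗ[ZMod 2] M} (nil : f (Finsupp.single [] 1) = g (Finsupp.single [] 1))
    (cons : ∀ a c, f c = g c → f (cone a c) = g (cone a c)) : f = g := by
  ext1 l
  ext1
  induction l with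
  | nil => exact nil
  | cons a l ih => simpa using cons a _ ih

/-- The boundary of a single ordered simplex. -/
noncomputable def listBoundary : List V → ListChain V
  | [] => 0
  | a :: l => Finsupp.single l 1 + cone a (listBoundary l)

/-- The boundary operator, which deletes the entries of a list one at a time. -/
noncomputable def boundary : ListChain V →ₗ[ZMod 2] ListChain V :=
  Finsupp.linearCombination (ZMod 2) listBoundary

@[simp] theorem boundary_single_nil : boundary (Finsupp.single ([] : List V) 1) = 0 := by
  simp [boundary, listBoundary]

theorem boundary_cone (a : V) (c : ListChain V) :
    boundary (cone a c) = c + cone a (boundary c) := by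
  have : boundary ∘ₗ cone a = LinearMap.id + cone a ∘ₗ boundary := by
    ext1 l
    ext1
    simp [boundary, listBoundary]
  exact LinearMap.congr_fun this c

/-- The chain map induced by a map of vertices. -/
noncomputable def map (f : V → W) : ListChain V →ₗ[ZMod 2] ListChain W :=
  Finsupp.lmapDomain _ _ (List.map f)

@[simp] theorem map_single (f : V → W) (l : List V) (r : ZMod 2) :
    map f (Finsupp.single l r) = Finsupp.single (l.map f) r := by
  simp [map]

theorem map_cone (f : V → W) (a : V) (c : ListChain V) :
    map f (cone a c) = cone (f a) (map f c) := by
  have : map f ∘ₗ cone a = cone (f a) ∘ₗ map f := by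
    ext1 l
    ext1
    simp
  exact LinearMap.congr_fun this c

theorem boundary_map (f : V → W) (c : ListChain V) :
    boundary (map f c) = map f (boundary c) := by
  have : boundary ∘ₗ map f = map f ∘ₗ boundary :=
    linearMap_ext (by simp) fun a c ih => by
      simp only [LinearMap.comp_apply] at ih ⊢
      rw [map_cone, boundary_cone, boundary_cone, ih, map_add, map_cone]
  exact LinearMap.congr_fun this c

theorem map_mem_chainsIn (f : V → W) {A : Set (List V)} {B : Set (List W)}
    (hAB : ∀ l ∈ A, l.map f ∈ B) {c : ListChain V} (hc : c ∈ chainsIn A) : map f c ∈ chainsIn B :=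
  map_mem_of_mem_supported _
    (fun l hl => by rw [map_single]; exact Finsupp.single_mem_supported _ _ (hAB l hl)) hc

/-- The prism over a single ordered simplex. -/
noncomputable def listPrism (f g : V → W) : List V → ListChain W
  | [] => 0
  | a :: l => Finsupp.single (f a :: g a :: l.map g) 1 + cone (f a) (listPrism f g l)

/-- The prism operator, a chain homotopy between the chain maps induced by two maps of vertices. -/
noncomputable def prism (f g : V → W) : ListChain V →ₗ[ZMod 2] ListChain W :=
  Finsupp.linearCombination (ZMod 2) (listPrism f g)

@[simp] theorem prism_single_nil (f g : V → W) : prism f g (Finsupp.single [] 1) = 0 := by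
  simp [prism, listPrism]

theorem prism_cone (f g : V → W) (a : V) (c : ListChain V) :
    prism f g (cone a c) = cone (f a) (cone (g a) (map g c)) + cone (f a) (prism f g c) := by
  have : prism f g ∘ₗ cone a =
      cone (f a) ∘ₗ cone (g a) ∘ₗ map g + cone (f a) ∘ₗ prism f g := by
    ext1 l
    ext1
    simp [prism, listPrism]
  exact LinearMap.congr_fun this c

theorem boundary_prism (f g : V → W) (c : ListChain V) :
    boundary (prism f g c) = map f c + map g c + prism f g (boundary c) := by
  have : boundary ∘ₗ prism f g = map f + map g + prism f g ∘ₗ boundary := by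
    refine linearMap_ext (by simp [ZModModule.add_self]) fun a c ih => ?_
    simp only [LinearMap.comp_apply, LinearMap.add_apply] at ih ⊢
    have hcancel := ZModModule.add_self (cone (f a) (map g c))
    simp only [prism_cone, boundary_cone, map_cone, boundary_map, ih, map_add]
    linear_combination (norm := abel) hcancel
  exact LinearMap.congr_fun this c

theorem prism_single_mem_chainsIn (f g : V → W) (l : List V) :
    prism f g (Finsupp.single l 1) ∈
      chainsIn {l' | l'.length = l.length + 1 ∧ ∀ x ∈ l', ∃ y ∈ l, x = f y ∨ x = g y} := by
  induction l with
  | nil => simp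
  | cons a l ih =>
    rw [← cone_single, prism_cone]
    refine Submodule.add_mem _ ?_ (map_mem_of_mem_supported _ (fun l' hl' => ?_) ih)
    · simp only [map_single, cone_single]
      exact Finsupp.single_mem_supported _ _ ⟨by simp, by grind⟩
    · rw [cone_single]
      exact Finsupp.single_mem_supported _ _ ⟨by simp [hl'.1], by grind⟩

theorem boundary_sum_prism (h : ℕ → V → W) (N : ℕ) {z : ListChain V} (hz : boundary z = 0) :
    boundary (∑ k ∈ Finset.range N, prism (h k) (h (k + 1)) z) = map (h 0) z + map (h N) z := by
  calc boundary (∑ k ∈ Finset.range N, prism (h k) (h (k + 1)) z)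
      = ∑ k ∈ Finset.range N, (map (h (k + 1)) z - map (h k) z) := by
        simp only [map_sum, boundary_prism, hz, map_zero, add_zero, ZModModule.sub_eq_add]
        simp only [add_comm]
    _ = map (h 0) z + map (h N) z := by
        rw [Finset.sum_range_sub fun k => map (h k) z, ZModModule.sub_eq_add, add_comm]

/-- The filling sweeps out the contraction: prisms between successive times of a fine partition of
the unit interval, and finally a cone over the degenerate chain at `w`. -/
theorem exists_boundary_eq_of_contraction (h : unitInterval → V → W) {w : W}
    (hw : ∀ x, h 1 x = w) {z : ListChain V} (hz : boundary z = 0)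
    {A : Set (List V)} (hzA : z ∈ chainsIn A) {B : Set (List W)} {δ : ℝ} (hδ : 0 < δ)
    (hB : ∀ l ∈ A, ∀ (t : unitInterval) (l' : List W), l'.length = l.length + 1 →
      (∀ x ∈ l', ∃ y ∈ l, ∃ u, dist u t < δ ∧ x = h u y) → l' ∈ B)
    (hBw : ∀ l ∈ A, List.replicate (l.length + 1) w ∈ B) :
    ∃ c ∈ chainsIn B, boundary c = map (h 0) z := by
  obtain ⟨N, hN⟩ := exists_nat_one_div_lt hδ
  let time (k : ℕ) : unitInterval := Set.projIcc 0 1 zero_le_one (k / (N + 1) : ℝ)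
  have time_zero : time 0 = 0 := by simp [time]
  have time_last : time (N + 1) = 1 := by simp [time, N.cast_add_one_ne_zero (R := ℝ)]
  have dist_time (k : ℕ) : dist (time (k + 1)) (time k) < δ := by
    refine lt_of_le_of_lt ?_ hN
    calc dist (time (k + 1)) (time k) ≤ dist ((k + 1 : ℕ) / (N + 1) : ℝ) (k / (N + 1)) :=
          (LipschitzWith.projIcc zero_le_one).dist_le_mul_of_le le_rfl |>.trans_eq (by simp)
      _ = 1 / (N + 1) := by
          rw [Real.dist_eq, ← sub_div, Nat.cast_succ, add_sub_cancel_left,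
            abs_of_pos (by positivity)]
  have map_last : map (h (time (N + 1))) z ∈ chainsIn {l' | w :: l' ∈ B} := by
    refine map_mem_chainsIn _ (fun l hl => ?_) hzA
    rw [time_last, List.map_congr_left fun x _ => hw x, List.map_const']
    exact hBw l hl
  refine ⟨∑ k ∈ Finset.range (N + 1), prism (h (time k)) (h (time (k + 1))) z +
    cone w (map (h (time (N + 1))) z), Submodule.add_mem _ (Submodule.sum_mem _ fun k _ => ?_)
      (map_mem_of_mem_supported _ (fun l' hl' => ?_) map_last), ?_⟩
  · refine map_mem_of_mem_supported _ (fun l hl => ?_) hzA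
    refine Finsupp.supported_mono ?_ (prism_single_mem_chainsIn _ _ l)
    rintro l' ⟨hlength, hl'⟩
    refine hB l hl (time k) l' hlength fun x hx => ?_
    obtain ⟨y, hy, rfl | rfl⟩ := hl' x hx
    exacts [⟨y, hy, _, by simpa using hδ, rfl⟩, ⟨y, hy, _, dist_time k, rfl⟩]
  · rw [cone_single]
    exact Finsupp.single_mem_supported _ _ hl'
  · rw [map_add, boundary_sum_prism (fun k => h (time k)) _ hz, boundary_cone, boundary_map, hz,
      map_zero, map_zero, add_zero, add_assoc, ZModModule.add_self, add_zero, time_zero]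

end ListChain

namespace SetChain

variable {V : Type*} [DecidableEq V]

/-- The boundary operator, which deletes the elements of a finite set one at a time. -/
noncomputable def boundary : SetChain V →ₗ[ZMod 2] SetChain V :=
  Finsupp.linearCombination (ZMod 2) fun F => ∑ x ∈ F, Finsupp.single (F.erase x) 1

theorem boundary_single (F : Finset V) :
    boundary (Finsupp.single F 1) = ∑ x ∈ F, Finsupp.single (F.erase x) 1 := by
  simp [boundary]

theorem boundary_single_ne_zero {F : Finset V} (hF : F.Nonempty) :
    boundary (Finsupp.single F 1) ≠ 0 := by
  obtain ⟨x, hx⟩ := hF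
  intro h
  have hcoeff := DFunLike.congr_fun h (F.erase x)
  rw [boundary_single, Finsupp.finsetSum_apply, Finset.sum_eq_single_of_mem x hx fun y hy hyx =>
    Finsupp.single_eq_of_ne fun h => hyx (F.erase_injOn hy hx h.symm)] at hcoeff
  simp at hcoeff

/-- The cone with apex `a`; it sends `F` to `insert a F`, or to zero if `a ∈ F`. -/
noncomputable def cone (a : V) : SetChain V →ₗ[ZMod 2] SetChain V :=
  Finsupp.linearCombination (ZMod 2) fun F => if a ∈ F then 0 else Finsupp.single (insert a F) 1

theorem cone_single (a : V) (F : Finset V) :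
    cone a (Finsupp.single F 1) = if a ∈ F then 0 else Finsupp.single (insert a F) 1 := by
  simp [cone]

theorem boundary_cone (a : V) (c : SetChain V) :
    boundary (cone a c) = c + cone a (boundary c) := by
  have : boundary ∘ₗ cone a = LinearMap.id + cone a ∘ₗ boundary := by
    ext1 F
    ext1
    simp only [LinearMap.comp_apply, Finsupp.lsingle_apply, LinearMap.add_apply, LinearMap.id_apply,
      cone_single, boundary_single, map_sum]
    split_ifs with ha
    · rw [map_zero, Finset.sum_eq_single_of_mem a ha fun b _ hb => by simp [ha, hb.symm]]
      simp [Finset.insert_erase ha, ZModModule.add_self]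
    · rw [boundary_single, Finset.sum_insert ha, Finset.erase_insert ha]
      congr 1
      refine Finset.sum_congr rfl fun x hx => ?_
      rw [if_neg (by simp [ha]), Finset.erase_insert_of_ne (ne_of_mem_of_not_mem hx ha).symm]
  exact LinearMap.congr_fun this c

theorem boundary_boundary_single (F : Finset V) :
    boundary (boundary (Finsupp.single F 1)) = 0 := by
  induction F using Finset.induction_on with
  | empty => simp [boundary]
  | insert a F ha ih =>
    have hcone : Finsupp.single (insert a F) (1 : ZMod 2) = cone a (Finsupp.single F 1) := by
      rw [cone_single, if_neg ha]
    rw [hcone, boundary_cone, map_add, boundary_cone, ih, map_zero, add_zero, ZModModule.add_self]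

/-- The simplex underlying a single ordered simplex: zero if a vertex is repeated. -/
noncomputable def ofSingleList : List V → SetChain V
  | [] => Finsupp.single ∅ 1
  | a :: l => cone a (ofSingleList l)

/-- The chain map that forgets the order of the vertices and kills degenerate simplices. -/
noncomputable def ofList : ListChain V →ₗ[ZMod 2] SetChain V :=
  Finsupp.linearCombination (ZMod 2) ofSingleList

@[simp] theorem ofList_single_nil :
    ofList (Finsupp.single ([] : List V) 1) = Finsupp.single ∅ 1 := by
  simp [ofList, ofSingleList]

theorem ofList_cone (a : V) (c : ListChain V) :
    ofList (ListChain.cone a c) = cone a (ofList c) := by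
  have : ofList ∘ₗ ListChain.cone a = cone a ∘ₗ ofList := by
    ext1 l
    ext1
    simp [ofList, ofSingleList]
  exact LinearMap.congr_fun this c

theorem boundary_ofList (c : ListChain V) :
    boundary (ofList c) = ofList (ListChain.boundary c) := by
  have : boundary ∘ₗ ofList = ofList ∘ₗ ListChain.boundary (V := V) :=
    ListChain.linearMap_ext (by simp [boundary]) fun a c ih => by
      simp only [LinearMap.comp_apply] at ih ⊢
      rw [ofList_cone, boundary_cone, ih, ListChain.boundary_cone, map_add, ofList_cone]
  exact LinearMap.congr_fun this c

theorem ofList_single_mem_chainsIn (l : List V) :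
    ofList (Finsupp.single l 1) ∈ chainsIn {F : Finset V | F.card = l.length ∧ ∀ x ∈ F, x ∈ l} := by
  induction l with
  | nil =>
    rw [ofList_single_nil]
    exact Finsupp.single_mem_supported _ _ (by simp)
  | cons a l ih =>
    rw [← ListChain.cone_single, ofList_cone]
    refine map_mem_of_mem_supported _ ?_ ih
    rintro F ⟨hcard, hF⟩
    rw [cone_single]
    split_ifs with ha
    · exact Submodule.zero_mem _
    · exact Finsupp.single_mem_supported _ _ ⟨by simp [ha, hcard], by grind⟩

/-- Acyclicity of a simplicial complex, encoded as the set `X` of its simplices with the empty one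
included, so that it amounts to the vanishing of the reduced mod 2 homology. -/
def IsAcyclic (X : Set (Finset V)) : Prop :=
  ∀ z ∈ chainsIn X, boundary z = 0 → ∃ c ∈ chainsIn X, boundary c = z

theorem eq_single_of_boundary_ne_zero {F : Finset V} {c : SetChain V}
    (hc : c ∈ chainsIn {G : Finset V | G.card = F.card ∧ G ⊆ F}) (hbd : boundary c ≠ 0) :
    c = Finsupp.single F 1 := by
  have hF : {G : Finset V | G.card = F.card ∧ G ⊆ F} = {F} := by
    ext G
    exact ⟨fun h => Finset.eq_of_subset_of_card_le h.2 h.1.ge, by rintro rfl; simp⟩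
  rw [hF, Finsupp.mem_supported] at hc
  obtain ⟨r, rfl⟩ := Finsupp.support_subset_singleton'.1 (by exact_mod_cast hc)
  have zero_or_one : ∀ r : ZMod 2, r = 0 ∨ r = 1 := by decide
  obtain rfl | rfl := zero_or_one r
  · simp at hbd
  · rfl

theorem eq_single_of_carried {X : Set (Finset V)} (hX : IsLowerSet X) {ψ : Finset V → SetChain V}
    (hψ_empty : ψ ∅ = Finsupp.single ∅ 1)
    (hψ_mem : ∀ F ∈ X, ψ F ∈ chainsIn {G : Finset V | G.card = F.card ∧ G ⊆ F})
    (hψ_boundary : ∀ F ∈ X, boundary (ψ F) = ∑ x ∈ F, ψ (F.erase x)) {F : Finset V} (hF : F ∈ X) :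
    ψ F = Finsupp.single F 1 := by
  induction F using Finset.strongInduction with
  | H F ih =>
  obtain rfl | hne := F.eq_empty_or_nonempty
  · exact hψ_empty
  · refine eq_single_of_boundary_ne_zero (hψ_mem F hF) ?_
    rw [hψ_boundary F hF, Finset.sum_congr rfl fun x hx =>
      ih _ (Finset.erase_ssubset hx) (hX (F.erase_subset x) hF), ← boundary_single]
    exact boundary_single_ne_zero hne

end SetChain

section AcyclicCarriers

variable {V W : Type*} [DecidableEq V]

open Classical in
/-- The chains obtained by the method of acyclic carriers: `carriedChain C F` is a chain in `C F`
filling the sum of the chains assigned to the facets of `F`, if there is one. -/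
noncomputable def carriedChain (C : Finset V → Set (List W)) (F : Finset V) : ListChain W :=
  if F = ∅ then Finsupp.single [] 1
  else
    let facetSum := ∑ x ∈ F.attach, carriedChain C (F.erase x)
    if h : ∃ c ∈ chainsIn (C F), ListChain.boundary c = facetSum then h.choose else 0
termination_by F.card
decreasing_by exact Finset.card_erase_lt_of_mem x.2

@[simp] theorem carriedChain_empty (C : Finset V → Set (List W)) :
    carriedChain C ∅ = Finsupp.single [] 1 := by
  rw [carriedChain, if_pos rfl]

theorem carriedChain_mem_and_boundary {C : Finset V → Set (List W)} {F : Finset V}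
    (hF : F.Nonempty) (h : ∃ c ∈ chainsIn (C F),
      ListChain.boundary c = ∑ x ∈ F, carriedChain C (F.erase x)) :
    carriedChain C F ∈ chainsIn (C F) ∧
      ListChain.boundary (carriedChain C F) = ∑ x ∈ F, carriedChain C (F.erase x) := by
  rw [← Finset.sum_attach] at h ⊢
  have hchoose : carriedChain C F = h.choose := by
    rw [carriedChain, if_neg hF.ne_empty]
    exact dif_pos h
  rw [hchoose]
  exact h.choose_spec

theorem sum_carriedChain_eq_linearCombination (C : Finset V → Set (List W)) (F : Finset V) :
    ∑ x ∈ F, carriedChain C (F.erase x) =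
      Finsupp.linearCombination (ZMod 2) (carriedChain C)
        (SetChain.boundary (Finsupp.single F 1)) := by
  simp [SetChain.boundary_single]

theorem carriedChain_spec {X : Set (Finset V)} (hX : IsLowerSet X) {C : Finset V → Set (List W)}
    (hC_empty : [] ∈ C ∅)
    (hC : ∀ F ∈ X, F.Nonempty → ∀ z ∈ chainsIn (⋃ x ∈ F, C (F.erase x)),
      ListChain.boundary z = 0 → ∃ c ∈ chainsIn (C F), ListChain.boundary c = z)
    {F : Finset V} (hF : F ∈ X) :
    carriedChain C F ∈ chainsIn (C F) ∧
      ListChain.boundary (carriedChain C F) = ∑ x ∈ F, carriedChain C (F.erase x) := by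
  induction F using Finset.strongInduction with
  | H F ih =>
  obtain rfl | hne := F.eq_empty_or_nonempty
  · simpa using Finsupp.single_mem_supported (ZMod 2) 1 hC_empty
  have hfacet {x : V} (hx : x ∈ F) :=
    ih _ (Finset.erase_ssubset hx) (hX (F.erase_subset x) hF)
  refine carriedChain_mem_and_boundary hne (hC F hF hne _ ?_ ?_)
  · exact Submodule.sum_mem _ fun x hx =>
      Finsupp.supported_mono (Set.subset_biUnion_of_mem (u := fun x => C (F.erase x)) hx)
        (hfacet hx).1
  · rw [map_sum, Finset.sum_congr rfl fun x hx =>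
      (hfacet hx).2.trans (sum_carriedChain_eq_linearCombination C _), ← map_sum]
    simp_rw [← map_sum]
    rw [← SetChain.boundary_single, SetChain.boundary_boundary_single, map_zero]

theorem carriedChain_eq_single {X : Set (Finset V)} (hX : IsLowerSet X)
    {C : Finset V → Set (List W)} (v : W → V)
    (hv : ∀ F ∈ X, ∀ l ∈ C F, l.length = F.card ∧ ∀ x ∈ l, v x ∈ F)
    (hspec : ∀ F ∈ X, carriedChain C F ∈ chainsIn (C F) ∧
      ListChain.boundary (carriedChain C F) = ∑ x ∈ F, carriedChain C (F.erase x))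
    {F : Finset V} (hF : F ∈ X) :
    SetChain.ofList (ListChain.map v (carriedChain C F)) = Finsupp.single F 1 := by
  refine SetChain.eq_single_of_carried (ψ := fun F => SetChain.ofList (ListChain.map v
    (carriedChain C F))) hX (by simp) (fun F hF => ?_) (fun F hF => ?_) hF
  · refine map_mem_of_mem_supported (SetChain.ofList ∘ₗ ListChain.map v) (fun l hl => ?_)
      (hspec F hF).1
    rw [LinearMap.comp_apply, ListChain.map_single]
    refine Finsupp.supported_mono ?_ (SetChain.ofList_single_mem_chainsIn _)
    rintro G ⟨hcard, hG⟩
    refine ⟨by rw [hcard, List.length_map, (hv F hF l hl).1], fun x hx => ?_⟩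
    obtain ⟨y, hy, rfl⟩ := List.mem_map.1 (hG x hx)
    exact (hv F hF l hl).2 y hy
  · rw [SetChain.boundary_ofList, ListChain.boundary_map, (hspec F hF).2, map_sum, map_sum]

/-- The cycle `z'` is a subdivision of `z` as in simplicial approximation: the vertex map `v` takes
it back to `z` because it takes the subdivision of each simplex to that simplex. -/
theorem exists_carried_cycle {X : Set (Finset V)} (hX : IsLowerSet X) {C : Finset V → Set (List W)}
    (hC_empty : [] ∈ C ∅)
    (hC : ∀ F ∈ X, F.Nonempty → ∀ z ∈ chainsIn (⋃ x ∈ F, C (F.erase x)),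
      ListChain.boundary z = 0 → ∃ c ∈ chainsIn (C F), ListChain.boundary c = z)
    (v : W → V) (hv : ∀ F ∈ X, ∀ l ∈ C F, l.length = F.card ∧ ∀ x ∈ l, v x ∈ F)
    {z : SetChain V} (hz : z ∈ chainsIn X) (hbd : SetChain.boundary z = 0) :
    ∃ z' ∈ chainsIn (⋃ F ∈ z.support, C F), ListChain.boundary z' = 0 ∧
      SetChain.ofList (ListChain.map v z') = z := by
  have hspec (F) (hF : F ∈ X) := carriedChain_spec hX hC_empty hC hF
  let Θ : SetChain V →ₗ[ZMod 2] ListChain W := Finsupp.linearCombination (ZMod 2) (carriedChain C)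
  have hΘ (F) : Θ (Finsupp.single F 1) = carriedChain C F := by simp [Θ]
  have boundary_Θ : ListChain.boundary (Θ z) = Θ (SetChain.boundary z) :=
    map_eq_map_of_mem_supported (f := ListChain.boundary ∘ₗ Θ) (g := Θ ∘ₗ SetChain.boundary)
      (fun F hF => by
        simp only [LinearMap.comp_apply]
        rw [hΘ, (hspec F hF).2, sum_carriedChain_eq_linearCombination]) hz
  refine ⟨Θ z, ?_, by rw [boundary_Θ, hbd, map_zero], ?_⟩
  · refine map_mem_of_mem_supported Θ (A := (z.support : Set (Finset V))) (fun F hF => ?_)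
      ((Finsupp.mem_supported _ _).2 subset_rfl)
    rw [hΘ]
    exact Finsupp.supported_mono (Set.subset_biUnion_of_mem (u := C) hF)
      (hspec F ((Finsupp.mem_supported _ _).1 hz hF)).1
  · exact map_eq_map_of_mem_supported (f := SetChain.ofList ∘ₗ ListChain.map v ∘ₗ Θ)
      (g := LinearMap.id) (fun F hF => by
        simp only [LinearMap.comp_apply]
        rw [hΘ, carriedChain_eq_single hX v hv hspec hF, LinearMap.id_apply]) hz

end AcyclicCarriers

/-! ### Fine ordered chains -/

section FineLists

variable {V : Type*} [SeminormedAddCommGroup V]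

/-- The lists of `n` points of `Y` with pairwise distances less than `ε`; they span the ordered
chains of a Vietoris–Rips complex. -/
def fineLists (ε : ℝ) (Y : Set V) (n : ℕ) : Set (List V) :=
  {l | l.length = n ∧ (∀ x ∈ l, x ∈ Y) ∧ ∀ x ∈ l, ∀ y ∈ l, dist x y < ε}

theorem eventually_forall_dist_add_lt {ε : ℝ} {S : Finset (List V)}
    (hS : ∀ l ∈ S, ∀ x ∈ l, ∀ y ∈ l, dist x y < ε) (w : V) :
    ∀ᶠ δ : ℝ in 𝓝[>] 0, ∀ l ∈ S, ∀ x ∈ l, ∀ y ∈ l, dist x y + 2 * δ * dist y w < ε := by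
  refine nhdsWithin_le_nhds <| (Filter.eventually_all_finset S).2 fun l hl =>
    (Filter.eventually_all_finite l.finite_toSet).2 fun x hx =>
    (Filter.eventually_all_finite l.finite_toSet).2 fun y hy => ?_
  have hcont : Continuous fun δ : ℝ => dist x y + 2 * δ * dist y w := by fun_prop
  exact hcont.continuousAt.eventually_lt continuousAt_const (by simpa using hS l hl x hx y hy)

variable [NormedSpace ℝ V]

theorem dist_lineMap_lineMap_le (x y w : V) {t u : ℝ} (ht : t ∈ Set.Icc 0 1) :
    dist (AffineMap.lineMap x w t) (AffineMap.lineMap y w u) ≤ dist x y + dist t u * dist y w := by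
  have hshrink : dist (AffineMap.lineMap x w t) (AffineMap.lineMap y w t) ≤ dist x y := by
    simp only [AffineMap.lineMap_apply_module]
    rw [dist_add_right, dist_smul₀, Real.norm_of_nonneg (by linarith [ht.2])]
    exact mul_le_of_le_one_left dist_nonneg (by linarith [ht.1])
  calc dist (AffineMap.lineMap x w t) (AffineMap.lineMap y w u)
      ≤ dist (AffineMap.lineMap x w t) (AffineMap.lineMap y w t) +
        dist (AffineMap.lineMap y w t) (AffineMap.lineMap y w u) := dist_triangle _ _ _
    _ ≤ dist x y + dist t u * dist y w := by rw [dist_lineMap_lineMap]; gcongr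

/-- Contract the convex set along straight lines to one of its points. -/
theorem exists_boundary_eq_of_convex {ε : ℝ} {Y : Set V} (hY : Convex ℝ Y)
    (hne : Y.Nonempty) (hε : 0 < ε) {n : ℕ} {z : ListChain V} (hz : z ∈ chainsIn (fineLists ε Y n))
    (hbd : ListChain.boundary z = 0) :
    ∃ c ∈ chainsIn (fineLists ε Y (n + 1)), ListChain.boundary c = z := by
  obtain ⟨w, hw⟩ := hne
  have hfine {l} (hl : l ∈ z.support) : l ∈ fineLists ε Y n := (Finsupp.mem_supported _ _).1 hz hl
  obtain ⟨δ, hδ, hδ_pos⟩ := ((eventually_forall_dist_add_lt (fun l hl => (hfine hl).2.2) w).and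
    self_mem_nhdsWithin).exists
  let h (t : unitInterval) (x : V) : V := AffineMap.lineMap x w (t : ℝ)
  have h_zero : h 0 = id := by ext; simp [h]
  have sweep_fine : ∀ l ∈ z.support, ∀ (t : unitInterval) (l' : List V),
      l'.length = l.length + 1 → (∀ x ∈ l', ∃ y ∈ l, ∃ u, dist u t < δ ∧ x = h u y) →
      l' ∈ fineLists ε Y (n + 1) := by
    intro l hl t l' hlength hl'
    refine ⟨by rw [hlength, (hfine hl).1], fun x' hx' => ?_, fun x' hx' y' hy' => ?_⟩
    · obtain ⟨x, hx, u, -, rfl⟩ := hl' x' hx'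
      exact hY.lineMap_mem ((hfine hl).2.1 x hx) hw u.2
    · obtain ⟨x, hx, u, hu, rfl⟩ := hl' x' hx'
      obtain ⟨y, hy, v, hv, rfl⟩ := hl' y' hy'
      have huv : dist (u : ℝ) v ≤ 2 * δ := by
        linarith [dist_triangle_right u v t, Subtype.dist_eq u v]
      calc dist (h u x) (h v y) ≤ dist x y + dist (u : ℝ) v * dist y w :=
            dist_lineMap_lineMap_le x y w u.2
        _ ≤ dist x y + 2 * δ * dist y w := by gcongr
        _ < ε := hδ l hl x hx y hy
  have replicate_fine : ∀ l ∈ z.support,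
      List.replicate (l.length + 1) w ∈ fineLists ε Y (n + 1) := by
    intro l hl
    refine ⟨by rw [List.length_replicate, (hfine hl).1], fun x hx => ?_, fun x hx y hy => ?_⟩
    · rwa [List.eq_of_mem_replicate hx]
    · rwa [List.eq_of_mem_replicate hx, List.eq_of_mem_replicate hy, dist_self]
  obtain ⟨c, hc, hcz⟩ := ListChain.exists_boundary_eq_of_contraction h (by simp [h]) hbd
    (Finsupp.mem_supported_support (ZMod 2) z) hδ_pos sweep_fine replicate_fine
  exact ⟨c, hc, by simpa [h_zero, ListChain.map] using hcz⟩

end FineLists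

/-! ### Selecting from open covers -/

theorem exists_selection_of_open_cover {X ι : Type*} [TopologicalSpace X] [NormalSpace X]
    [Finite ι] {u : ι → Set X} (hu : ∀ i, IsOpen (u i)) (hcover : ∀ x, ∃ i, x ∈ u i) :
    ∃ v : X → ι, ∀ x, ∀ᶠ x' in 𝓝 x, x ∈ u (v x') := by
  obtain ⟨F, hF_cover, hF_closed, hFu⟩ := exists_iUnion_eq_closed_subset hu
    (fun _ => Set.toFinite _) (Set.iUnion_eq_univ_iff.2 hcover)
  choose v hv using Set.iUnion_eq_univ_iff.1 hF_cover
  refine ⟨v, fun x => ?_⟩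
  filter_upwards [(locallyFinite_of_finite F).eventually_subset hF_closed x] with x' hx'
  exact hFu _ (hx' (hv x'))

theorem eventually_forall_exists_mapsTo_ball {X Y : Type*} [PseudoMetricSpace X]
    [TopologicalSpace Y] {Q : Set X} (hQ : IsCompact Q) {f : X → Y} (hf : ContinuousOn f Q)
    {U : Y → Set Y} (hU : ∀ y, U y ∈ 𝓝 y) :
    ∀ᶠ δ in 𝓝[>] (0 : ℝ), ∀ q ∈ Q, ∃ y, Set.MapsTo f (Q ∩ Metric.ball q δ) (U y) := by
  obtain ⟨ε, hε, h⟩ := Metric.uniformity_basis_dist.lebesgue_number_lemma_nhdsWithin hQ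
    fun x hx => hf x hx (hU (f x))
  filter_upwards [Ioo_mem_nhdsGT hε] with δ hδ q hq
  obtain ⟨y, hy⟩ := h q hq
  exact ⟨f y, fun q' hq' => hy ⟨(Metric.mem_ball'.1 hq'.2).trans hδ.2, hq'.1⟩⟩

/-! ### Open stars -/

section OpenStar

variable {V : Type*} [NormedAddCommGroup V] [NormedSpace ℝ V]

/-- The open star of a vertex `x` of a simplicial complex: the points that lie only in simplices
having `x` as a vertex. -/
def openStar (K : Geometry.SimplicialComplex ℝ V) (x : V) : Set K.space :=
  {y | ∀ s ∈ K.faces, (y : V) ∈ convexHull ℝ (s : Set V) → x ∈ s}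

variable {K : Geometry.SimplicialComplex ℝ V}

theorem isClosed_convexHull_finset (s : Finset V) : IsClosed (convexHull ℝ (s : Set V)) :=
  (s.finite_toSet.isCompact_convexHull ℝ).isClosed

theorem isOpen_openStar (hK : K.faces.Finite) (x : V) : IsOpen (openStar K x) := by
  have hstar : openStar K x =
      ⋂ s ∈ {s ∈ K.faces | x ∉ s}, ((↑) : K.space → V) ⁻¹' (convexHull ℝ (s : Set V))ᶜ := by
    ext y
    simp only [openStar, Set.mem_iInter, Set.mem_preimage, Set.mem_compl_iff, Set.mem_ofPred_eq,
      and_imp]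
    exact forall₂_congr fun _ _ => not_imp_not.symm
  rw [hstar]
  exact (hK.subset (Set.sep_subset _ _)).isOpen_biInter fun s _ =>
    (isClosed_convexHull_finset s).isOpen_compl.preimage continuous_subtype_val

/-- Any vertex of a simplex of least dimension containing the point will do. -/
theorem exists_mem_openStar (y : K.space) : ∃ x ∈ K.vertices, y ∈ openStar K x := by
  classical
  obtain ⟨s₀, hs₀, hys₀⟩ := K.mem_space_iff.1 y.2
  obtain ⟨s, ⟨hs, hys⟩, hmin⟩ := exists_minimal_of_wellFoundedLT
    (fun s => s ∈ K.faces ∧ (y : V) ∈ convexHull ℝ (s : Set V)) ⟨s₀, hs₀, hys₀⟩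
  obtain ⟨x, hx⟩ := K.nonempty_of_mem_faces hs
  refine ⟨x, K.down_closed hs (by simpa using hx) (by simp), fun t ht hyt => ?_⟩
  have hyst : (y : V) ∈ convexHull ℝ ((s ∩ t : Finset V) : Set V) := by
    rw [Finset.coe_inter]
    exact K.inter_subset_convexHull hs ht ⟨hys, hyt⟩
  have hne : (s ∩ t).Nonempty := by exact_mod_cast convexHull_nonempty_iff.1 ⟨_, hyst⟩
  have hsub : s ⊆ s ∩ t :=
    hmin ⟨K.down_closed hs Finset.inter_subset_left hne, hyst⟩ Finset.inter_subset_left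
  exact (Finset.mem_inter.1 (hsub hx)).2

theorem exists_eventually_mem_openStar (hK : K.faces.Finite) :
    ∃ v : K.space → V, ∀ y, ∀ᶠ z in 𝓝 y, y ∈ openStar K (v z) := by
  have : Finite K.vertices := (hK.preimage Finset.singleton_injective.injOn).to_subtype
  obtain ⟨v, hv⟩ := exists_selection_of_open_cover
    (fun x : K.vertices => isOpen_openStar hK x) fun y => by simpa using exists_mem_openStar y
  exact ⟨fun z => v z, hv⟩

end OpenStar

/-! ### The lifted triangulation -/

theorem exists_lift_of_contraction {E X A : Type*} [TopologicalSpace E] [TopologicalSpace X]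
    [TopologicalSpace A] {p : E → X} (hp : IsCoveringMap p) {f : C(A, X)}
    (H : C(unitInterval × A, X)) {a : A} {e : E} (H_zero : ∀ b, H (0, b) = p e)
    (H_one : ∀ b, H (1, b) = f b) (H_base : ∀ t, H (t, a) = p e) :
    ∃ g : C(A, E), (∀ b, p (g b) = f b) ∧ g a = e := by
  let L := hp.liftHomotopy H (ContinuousMap.const _ e) H_zero
  have hL (q) : p (L q) = H q := congrFun (hp.liftHomotopy_lifts H _ H_zero) q
  refine ⟨⟨fun b => L (1, b), by fun_prop⟩, fun b => (hL _).trans (H_one b), ?_⟩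
  calc L (1, a) = L (0, a) := hp.const_of_comp (g := fun t : unitInterval => L (t, a))
        (by fun_prop) (fun t t' => by rw [hL, hL, H_base, H_base]) 1 0
    _ = e := hp.liftHomotopy_zero H _ H_zero a

section Lift

variable {V : Type*} [NormedAddCommGroup V] [NormedSpace ℝ V]
variable {K : Geometry.SimplicialComplex ℝ V} {E : Type*} [TopologicalSpace E]

/-- `s` spans a (possibly empty) simplex of `K`, and `ℓ` restricts to a continuous lift of this
simplex along `p`. -/
structure IsSimplexLift (p : E → K.space) (s : Finset V) (ℓ : V → E) : Prop where
  mem_faces : s.Nonempty → s ∈ K.faces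
  continuousOn : ContinuousOn ℓ (convexHull ℝ (s : Set V))
  apply_eq : ∀ x ∈ convexHull ℝ (s : Set V), (p (ℓ x) : V) = x

variable {p : E → K.space} {s s' : Finset V} {ℓ ℓ' : V → E}

theorem mem_convexHull_of_mem {x : V} (hx : x ∈ s) : x ∈ convexHull ℝ (s : Set V) :=
  subset_convexHull ℝ _ hx

namespace IsSimplexLift

theorem mono (hℓ : IsSimplexLift p s ℓ) (hs : s' ⊆ s) : IsSimplexLift p s' ℓ :=
  have hhull : convexHull ℝ (s' : Set V) ⊆ convexHull ℝ (s : Set V) := convexHull_mono hs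
  ⟨fun hne => K.down_closed (hℓ.mem_faces (hne.mono hs)) hs hne, hℓ.continuousOn.mono hhull,
    fun x hx => hℓ.apply_eq x (hhull hx)⟩

theorem injOn (hℓ : IsSimplexLift p s ℓ) : Set.InjOn ℓ (convexHull ℝ (s : Set V)) :=
  fun x hx y hy hxy => by rw [← hℓ.apply_eq x hx, ← hℓ.apply_eq y hy, hxy]

theorem smul {Γ : Type*} [Group Γ] [MulAction Γ E] (hp : IsQuotientCoveringMap p Γ)
    (hℓ : IsSimplexLift p s ℓ) (γ : Γ) : IsSimplexLift p s fun x => γ • ℓ x :=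
  have := hp.toContinuousConstSMul
  ⟨hℓ.mem_faces, hℓ.continuousOn.const_smul γ,
    fun x hx => by rw [hp.map_smul]; exact hℓ.apply_eq x hx⟩

theorem eq_of_eq (hp : IsCoveringMap p) (hℓ : IsSimplexLift p s ℓ) (hℓ' : IsSimplexLift p s' ℓ')
    {x : V} (hx : x ∈ convexHull ℝ (s : Set V)) (hx' : x ∈ convexHull ℝ (s' : Set V))
    (hxx : ℓ x = ℓ' x) {y : V} (hy : y ∈ convexHull ℝ (s : Set V))
    (hy' : y ∈ convexHull ℝ (s' : Set V)) : ℓ y = ℓ' y :=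
  hp.eqOn_of_comp_eqOn
    ((convex_convexHull ℝ (s : Set V)).inter (convex_convexHull ℝ (s' : Set V))).isPreconnected
    (hℓ.continuousOn.mono Set.inter_subset_left) (hℓ'.continuousOn.mono Set.inter_subset_right)
    (fun z hz => Subtype.ext ((hℓ.apply_eq z hz.1).trans (hℓ'.apply_eq z hz.2).symm))
    ⟨hx, hx'⟩ hxx ⟨hy, hy'⟩

variable [DecidableEq E]

theorem mem_of_image_subset (hℓ : IsSimplexLift p s ℓ) (hℓ' : IsSimplexLift p s' ℓ')
    (h : s.image ℓ ⊆ s'.image ℓ') {x : V} (hx : x ∈ s) : x ∈ s' ∧ ℓ x = ℓ' x := by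
  obtain ⟨x', hx', hxx⟩ := Finset.mem_image.1 (h (Finset.mem_image_of_mem ℓ hx))
  obtain rfl : x' = x := by
    rw [← hℓ'.apply_eq x' (mem_convexHull_of_mem hx'), hxx,
      hℓ.apply_eq x (mem_convexHull_of_mem hx)]
  exact ⟨hx', hxx.symm⟩

theorem eq_of_image_eq (hℓ : IsSimplexLift p s ℓ) (hℓ' : IsSimplexLift p s' ℓ')
    (h : s.image ℓ = s'.image ℓ') : s = s' :=
  Finset.Subset.antisymm (fun _ hx => (hℓ.mem_of_image_subset hℓ' h.subset hx).1)
    fun _ hx => (hℓ'.mem_of_image_subset hℓ h.superset hx).1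

theorem eqOn_of_image_eq (hp : IsCoveringMap p) (hℓ : IsSimplexLift p s ℓ)
    (hℓ' : IsSimplexLift p s ℓ') (h : s.image ℓ = s.image ℓ') :
    Set.EqOn ℓ ℓ' (convexHull ℝ (s : Set V)) := by
  intro y hy
  obtain ⟨x, hx⟩ := (convexHull_nonempty_iff (𝕜 := ℝ)).1 ⟨y, hy⟩
  have hx' := mem_convexHull_of_mem (Finset.mem_coe.1 hx)
  exact hℓ.eq_of_eq hp hℓ' hx' hx' (hℓ.mem_of_image_subset hℓ' h.subset hx).2 hy hy

end IsSimplexLift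

theorem exists_isSimplexLift (hp : IsCoveringMap p) (hs : s ∈ K.faces) {e : E}
    (he : (p e : V) ∈ convexHull ℝ (s : Set V)) : ∃ ℓ, IsSimplexLift p s ℓ ∧ ℓ (p e) = e := by
  let Δ := convexHull ℝ (s : Set V)
  let f : C(Δ, K.space) := ⟨Set.inclusion (K.convexHull_subset_space hs), by fun_prop⟩
  let H : C(unitInterval × Δ, K.space) :=
    ⟨fun q => f ⟨AffineMap.lineMap (p e : V) (q.2 : V) (q.1 : ℝ),
      (convex_convexHull ℝ (s : Set V)).lineMap_mem he q.2.2 q.1.2⟩, by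
      simp only [AffineMap.lineMap_apply_module]
      fun_prop⟩
  obtain ⟨g, hpg, hge⟩ := exists_lift_of_contraction hp (f := f) H (a := ⟨p e, he⟩) (e := e)
    (fun b => Subtype.ext (by simp [H, f])) (fun b => Subtype.ext (by simp [H, f]))
    (fun t => Subtype.ext (by simp [H, f]))
  let ℓ : V → E := Function.extend Subtype.val g fun _ => e
  have hℓ (x : Δ) : ℓ x = g x := Subtype.val_injective.extend_apply _ _ x
  refine ⟨ℓ, ⟨fun _ => hs, ?_, fun x hx => ?_⟩, (hℓ ⟨p e, he⟩).trans hge⟩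
  · exact continuousOn_iff_continuous_domRestrict.2 (g.continuous.congr fun x => (hℓ x).symm)
  · rw [hℓ ⟨x, hx⟩, hpg]
    rfl

theorem IsSimplexLift.eventually_apply_eq (hp : IsCoveringMap p) (hℓ : IsSimplexLift p s ℓ) {e : E}
    (hes : (p e : V) ∈ convexHull ℝ (s : Set V)) (hℓe : ℓ (p e) = e) :
    ∀ᶠ e' in 𝓝 e, (p e' : V) ∈ convexHull ℝ (s : Set V) → ℓ (p e') = e' := by
  obtain ⟨U, hU, heU, hpU⟩ := hp.isLocalHomeomorph.isLocallyInjective e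
  have hp_cont : Continuous fun e => (p e : V) := continuous_subtype_val.comp hp.continuous
  have hℓp : ContinuousWithinAt (fun e => ℓ (p e)) {e' | (p e' : V) ∈ convexHull ℝ (s : Set V)} e :=
    (hℓ.continuousOn _ hes).comp (f := fun e => (p e : V)) hp_cont.continuousWithinAt fun _ h => h
  have hℓpU : ∀ᶠ e' in 𝓝 e, (p e' : V) ∈ convexHull ℝ (s : Set V) → ℓ (p e') ∈ U :=
    eventually_nhdsWithin_iff.1 (hℓp.eventually_mem (hU.mem_nhds (show ℓ (p e) ∈ U by rwa [hℓe])))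
  filter_upwards [hU.mem_nhds heU, hℓpU] with e' he'U hℓU he's
  exact hpU (hℓU he's) he'U (Subtype.ext (hℓ.apply_eq _ he's))

variable [DecidableEq E]

/-- The abstract simplicial complex of the lifted triangulation of a covering space, the empty
simplex included. -/
def liftedFaces (p : E → K.space) : Set (Finset E) :=
  {F | ∃ s ℓ, IsSimplexLift p s ℓ ∧ s.image ℓ = F}

/-- The closed simplex spanned by `F` in the lifted triangulation. -/
def realization (p : E → K.space) (F : Finset E) : Set E :=
  {e | ∃ s ℓ, IsSimplexLift p s ℓ ∧ s.image ℓ = F ∧ (p e : V) ∈ convexHull ℝ (s : Set V) ∧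
    ℓ (p e) = e}

theorem isLowerSet_liftedFaces (p : E → K.space) : IsLowerSet (liftedFaces p) := by
  rintro _ G hG ⟨s, ℓ, hℓ, rfl⟩
  obtain ⟨t, hts, rfl⟩ := Finset.subset_image_iff.1 hG
  exact ⟨t, ℓ, hℓ.mono hts, rfl⟩

theorem realization_image (hp : IsCoveringMap p) (hℓ : IsSimplexLift p s ℓ) :
    realization p (s.image ℓ) = ℓ '' convexHull ℝ (s : Set V) := by
  ext e
  constructor
  · rintro ⟨s', ℓ', hℓ', himage, hes', hℓ'e⟩
    obtain rfl := hℓ'.eq_of_image_eq hℓ himage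
    exact ⟨p e, hes', by rw [← hℓ'.eqOn_of_image_eq hp hℓ himage hes', hℓ'e]⟩
  · rintro ⟨y, hy, rfl⟩
    exact ⟨s, ℓ, hℓ, rfl, by rwa [hℓ.apply_eq y hy], by rw [hℓ.apply_eq y hy]⟩

theorem realization_mono (hp : IsCoveringMap p) {F G : Finset E} (hF : F ∈ liftedFaces p)
    (hGF : G ⊆ F) : realization p G ⊆ realization p F := by
  obtain ⟨s, ℓ, hℓ, rfl⟩ := hF
  obtain ⟨t, hts, rfl⟩ := Finset.subset_image_iff.1 hGF
  rw [realization_image hp hℓ, realization_image hp (hℓ.mono hts)]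
  exact Set.image_mono (convexHull_mono hts)

theorem exists_mem_realization (hp : IsCoveringMap p) (e : E) :
    ∃ F ∈ liftedFaces p, e ∈ realization p F := by
  obtain ⟨s, hs, hes⟩ := K.mem_space_iff.1 (p e).2
  obtain ⟨ℓ, hℓ, hℓe⟩ := exists_isSimplexLift hp hs hes
  exact ⟨_, ⟨s, ℓ, hℓ, rfl⟩, s, ℓ, hℓ, rfl, hes, hℓe⟩

theorem exists_isSimplexLift_of_mem_realization {F : Finset E} {e : E} (he : e ∈ realization p F) :
    ∃ s ∈ K.faces, ∃ ℓ, IsSimplexLift p s ℓ ∧ s.image ℓ = F ∧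
      (p e : V) ∈ convexHull ℝ (s : Set V) ∧ ℓ (p e) = e := by
  obtain ⟨s, ℓ, hℓ, himage, hes, hℓe⟩ := he
  have hne : s.Nonempty := by exact_mod_cast convexHull_nonempty_iff.1 ⟨_, hes⟩
  exact ⟨s, hℓ.mem_faces hne, ℓ, hℓ, himage, hes, hℓe⟩

theorem eventually_mem_realization (hK : K.faces.Finite) (hp : IsCoveringMap p) (e : E) :
    ∀ᶠ e' in 𝓝 e, ∀ F, e' ∈ realization p F → e ∈ realization p F := by
  have hp_cont : Continuous fun e => (p e : V) := continuous_subtype_val.comp hp.continuous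
  have hnear : ∀ᶠ e' in 𝓝 e, ∀ s ∈ K.faces, (p e' : V) ∈ convexHull ℝ (s : Set V) →
      (p e : V) ∈ convexHull ℝ (s : Set V) ∧
        ∀ ℓ, IsSimplexLift p s ℓ → ℓ (p e') = e' → ℓ (p e) = e := by
    refine (Filter.eventually_all_finite hK).2 fun s hs => ?_
    by_cases hes : (p e : V) ∈ convexHull ℝ (s : Set V)
    · obtain ⟨ℓ₀, hℓ₀, hℓ₀e⟩ := exists_isSimplexLift hp hs hes
      filter_upwards [hℓ₀.eventually_apply_eq hp hes hℓ₀e] with e' he' he's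
      exact ⟨hes, fun ℓ hℓ hℓe' =>
        (hℓ.eq_of_eq hp hℓ₀ he's he's (hℓe'.trans (he' he's).symm) hes hes).trans hℓ₀e⟩
    · filter_upwards [hp_cont.continuousAt.eventually_mem
        ((isClosed_convexHull_finset s).isOpen_compl.mem_nhds hes)] with e' he' he's
      exact absurd he's he'
  filter_upwards [hnear] with e' he'
  intro F he'F
  obtain ⟨s, hs, ℓ, hℓ, rfl, he's, hℓe'⟩ := exists_isSimplexLift_of_mem_realization he'F
  obtain ⟨hes, hℓe⟩ := he' s hs he's
  exact ⟨s, ℓ, hℓ, rfl, hes, hℓe ℓ hℓ hℓe'⟩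

/-- A vertex map of the base lifts to the covering space: `e` lies in a lifted simplex over a
simplex with vertex `v (p e)`, and the lift of this vertex does not depend on the choice. -/
theorem exists_lifted_vertex_map (hK : K.faces.Finite) (hp : IsCoveringMap p) :
    ∃ v : E → E, (∀ F, ∀ e ∈ realization p F, v e ∈ F) ∧
      ∀ e, ∃ F ∈ liftedFaces p, ∀ᶠ e' in 𝓝 e, v e' ∈ F := by
  obtain ⟨v, hv⟩ := exists_eventually_mem_openStar hK
  choose F hF heF using exists_mem_realization hp
  choose s hs ℓ hℓ himage _ _ using fun e => exists_isSimplexLift_of_mem_realization (heF e)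
  have mem_of_star {e e' : E} (he : e ∈ realization p (F e')) (hstar : p e ∈ openStar K (v (p e')))
      {G : Finset E} (hG : e ∈ realization p G) : ℓ e' (v (p e')) ∈ G := by
    obtain ⟨t, ht, k, hk, rfl, het, hke⟩ := exists_isSimplexLift_of_mem_realization hG
    rw [← himage, realization_image hp (hℓ e')] at he
    obtain ⟨y, hy, hye⟩ := he
    obtain rfl : (p e : V) = y := by rw [← hye, (hℓ e').apply_eq y hy]
    have hvt := hstar t ht het
    rw [(hℓ e').eq_of_eq hp hk hy het (hye.trans hke.symm)
      (mem_convexHull_of_mem (hstar _ (hs e') hy)) (mem_convexHull_of_mem hvt)]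
    exact Finset.mem_image_of_mem k hvt
  refine ⟨fun e => ℓ e (v (p e)), fun G e he => mem_of_star (heF e) (hv (p e)).self_of_nhds he,
    fun e => ⟨F e, hF e, ?_⟩⟩
  filter_upwards [eventually_mem_realization hK hp e, hp.continuous.continuousAt.eventually
    (hv (p e))] with e' he' hstar
  exact mem_of_star (he' _ (heF e')) hstar (heF e)

end Lift

/-! ### Acyclicity of the lifted triangulation -/

section Acyclic

variable {V : Type*} [NormedAddCommGroup V] [NormedSpace ℝ V]
variable {K : Geometry.SimplicialComplex ℝ V} {E : Type*} [TopologicalSpace E]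
variable {p : E → K.space} [DecidableEq E]

/-- The fine ordered simplices of full dimension in the closed lifted simplex spanned by `F`, the
distances being measured in the base. -/
def fineLiftedLists (p : E → K.space) (ε : ℝ) (F : Finset E) : Set (List E) :=
  {l | (∀ e ∈ l, e ∈ realization p F) ∧ l.map (fun e => (p e : V)) ∈ fineLists ε Set.univ F.card}

theorem IsSimplexLift.map_mem_fineLiftedLists {s : Finset V} {ℓ : V → E} (hp : IsCoveringMap p)
    (hℓ : IsSimplexLift p s ℓ) {ε : ℝ} {l : List V}
    (hl : l ∈ fineLists ε (convexHull ℝ (s : Set V)) s.card) :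
    l.map ℓ ∈ fineLiftedLists p ε (s.image ℓ) := by
  obtain ⟨hlength, hls, hdist⟩ := hl
  have hpℓ : (l.map ℓ).map (fun e => (p e : V)) = l := by
    rw [List.map_map]
    exact (List.map_congr_left fun y hy => hℓ.apply_eq y (hls y hy)).trans (List.map_id l)
  refine ⟨?_, hpℓ.symm ▸ ⟨hlength.trans ?_, fun _ _ => trivial, hdist⟩⟩
  · rw [realization_image hp hℓ]
    exact List.forall_mem_map.2 fun y hy => Set.mem_image_of_mem ℓ (hls y hy)
  · rw [Finset.card_image_of_injOn (hℓ.injOn.mono (subset_convexHull ℝ _))]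

theorem exists_boundary_eq_fineLiftedLists (hp : IsCoveringMap p) {ε : ℝ} (hε : 0 < ε)
    {F : Finset E} (hF : F ∈ liftedFaces p) (hne : F.Nonempty) {z : ListChain E}
    (hz : z ∈ chainsIn (⋃ x ∈ F, fineLiftedLists p ε (F.erase x)))
    (hbd : ListChain.boundary z = 0) :
    ∃ c ∈ chainsIn (fineLiftedLists p ε F), ListChain.boundary c = z := by
  obtain ⟨s, ℓ, hℓ, rfl⟩ := id hF
  let q (e : E) : V := p e
  have hz_facet {l : List E} (hl : l ∈ ⋃ x ∈ s.image ℓ, fineLiftedLists p ε ((s.image ℓ).erase x)) :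
      (∀ e ∈ l, q e ∈ convexHull ℝ (s : Set V) ∧ ℓ (q e) = e) ∧
        l.map q ∈ fineLists ε Set.univ (s.card - 1) := by
    obtain ⟨x, hx, hlx, hfine⟩ := Set.mem_iUnion₂.1 hl
    rw [Finset.card_erase_of_mem hx,
      Finset.card_image_of_injOn (hℓ.injOn.mono (subset_convexHull ℝ _))] at hfine
    refine ⟨fun e he => ?_, hfine⟩
    have he_mem := realization_mono hp hF (Finset.erase_subset x _) (hlx e he)
    rw [realization_image hp hℓ] at he_mem
    obtain ⟨y, hy, rfl⟩ := he_mem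
    have hqy : q (ℓ y) = y := hℓ.apply_eq y hy
    exact ⟨hqy.symm ▸ hy, congrArg ℓ hqy⟩
  have hqz : ListChain.map q z ∈
      chainsIn (fineLists ε (convexHull ℝ (s : Set V)) (s.card - 1)) := by
    refine ListChain.map_mem_chainsIn q (fun l hl => ?_) hz
    obtain ⟨hlℓ, hlength, -, hdist⟩ := hz_facet hl
    exact ⟨hlength, List.forall_mem_map.2 fun e he => (hlℓ e he).1, hdist⟩
  have hs_ne : s.Nonempty := by simpa using hne
  obtain ⟨c, hc, hcz⟩ := exists_boundary_eq_of_convex (convex_convexHull ℝ (s : Set V))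
    (convexHull_nonempty_iff.2 (by exact_mod_cast hs_ne)) hε hqz
    (by rw [ListChain.boundary_map, hbd, map_zero])
  rw [Nat.sub_add_cancel hs_ne.card_pos] at hc
  refine ⟨ListChain.map ℓ c,
    ListChain.map_mem_chainsIn ℓ (fun l hl => hℓ.map_mem_fineLiftedLists hp hl) hc, ?_⟩
  rw [ListChain.boundary_map, hcz]
  refine map_eq_map_of_mem_supported (f := ListChain.map ℓ ∘ₗ ListChain.map q)
    (g := LinearMap.id) (fun l hl => ?_) hz
  have hℓq : (l.map q).map ℓ = l := by
    rw [List.map_map]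
    exact (List.map_congr_left fun e he => ((hz_facet hl).1 e he).2).trans (List.map_id l)
  rw [LinearMap.comp_apply, ListChain.map_single, ListChain.map_single, hℓq, LinearMap.id_apply]

theorem eventually_contraction_mem (hp : IsCoveringMap p) (H : C(unitInterval × E, E))
    {U : E → Set E} (hU : ∀ e, U e ∈ 𝓝 e) {F : Finset E} (hF : F ∈ liftedFaces p) :
    ∀ᶠ ε in 𝓝[>] (0 : ℝ), ∀ e₀ ∈ realization p F, ∀ t₀, ∃ e', ∀ e ∈ realization p F, ∀ t,
      dist (p e : V) (p e₀) < ε → dist t t₀ < ε → H (t, e) ∈ U e' := by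
  obtain ⟨s, ℓ, hℓ, rfl⟩ := hF
  let Q : Set (unitInterval × V) := Set.univ ×ˢ convexHull ℝ (s : Set V)
  have hQ : IsCompact Q := isCompact_univ.prod (s.finite_toSet.isCompact_convexHull ℝ)
  have hHℓ : ContinuousOn (fun q : unitInterval × V => H (q.1, ℓ q.2)) Q :=
    H.continuous.comp_continuousOn (continuousOn_fst.prodMk
      (hℓ.continuousOn.comp continuousOn_snd fun q hq => hq.2))
  filter_upwards [eventually_forall_exists_mapsTo_ball hQ hHℓ hU] with ε hε e₀ he₀ t₀
  rw [realization_image hp hℓ] at he₀ ⊢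
  obtain ⟨y₀, hy₀, rfl⟩ := he₀
  obtain ⟨e', he'⟩ := hε (t₀, y₀) ⟨trivial, hy₀⟩
  refine ⟨e', Set.forall_mem_image.2 fun y hy t hdist ht => ?_⟩
  refine he' (x := (t, y)) ⟨⟨trivial, hy⟩, Metric.mem_ball.2 (max_lt ht ?_)⟩
  rwa [hℓ.apply_eq y hy, hℓ.apply_eq y₀ hy₀] at hdist

theorem exists_boundary_eq_of_contractible [ContractibleSpace E] (hp : IsCoveringMap p)
    {𝓕 : Finset (Finset E)} (h𝓕 : ∀ F ∈ 𝓕, F ∈ liftedFaces p) {U : E → Set E}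
    (hU : ∀ e, U e ∈ 𝓝 e) :
    ∀ᶠ ε in 𝓝[>] (0 : ℝ), ∀ z ∈ chainsIn (⋃ F ∈ 𝓕, fineLiftedLists p ε F),
      ListChain.boundary z = 0 →
        ∃ c ∈ chainsIn {l | ∃ e', ∀ e ∈ l, e ∈ U e'}, ListChain.boundary c = z := by
  obtain ⟨w, ⟨H⟩⟩ := id_nullhomotopic E
  have hsmall := (Filter.eventually_all_finset 𝓕).2 fun F hF =>
    eventually_contraction_mem hp H.toContinuousMap hU (h𝓕 F hF)
  filter_upwards [hsmall, self_mem_nhdsWithin] with ε hεH hε z hz hbd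
  have hsweep : ∀ l ∈ ⋃ F ∈ 𝓕, fineLiftedLists p ε F, ∀ (t : unitInterval) (l' : List E),
      l'.length = l.length + 1 → (∀ x ∈ l', ∃ e ∈ l, ∃ u, dist u t < ε ∧ x = H (u, e)) →
        ∃ e', ∀ x ∈ l', x ∈ U e' := by
    intro l hl t l' hlength hl'
    obtain ⟨F, hF, hlF, -, -, hdist⟩ := Set.mem_iUnion₂.1 hl
    obtain ⟨x₀, hx₀⟩ := List.exists_mem_of_length_pos (l := l') (by omega)
    obtain ⟨e₀, he₀, -⟩ := hl' x₀ hx₀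
    obtain ⟨e', he'⟩ := hεH F hF e₀ (hlF e₀ he₀) t
    refine ⟨e', fun x hx => ?_⟩
    obtain ⟨e, he, u, hu, rfl⟩ := hl' x hx
    exact he' e (hlF e he) u (hdist _ (List.mem_map_of_mem he) _ (List.mem_map_of_mem he₀)) hu
  have hconst (l : List E) (_ : l ∈ ⋃ F ∈ 𝓕, fineLiftedLists p ε F) :
      ∃ e', ∀ x ∈ List.replicate (l.length + 1) w, x ∈ U e' :=
    ⟨w, fun x hx => (List.eq_of_mem_replicate hx).symm ▸ mem_of_mem_nhds (hU w)⟩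
  obtain ⟨c, hc, hcz⟩ := ListChain.exists_boundary_eq_of_contraction (fun t e => H (t, e))
    (w := w) (fun e => by simp) hbd hz (B := {l | ∃ e', ∀ e ∈ l, e ∈ U e'}) hε hsweep hconst
  refine ⟨c, hc, hcz.trans ?_⟩
  simp [ListChain.map]

theorem isAcyclic_liftedFaces [ContractibleSpace E] (hK : K.faces.Finite) (hp : IsCoveringMap p) :
    SetChain.IsAcyclic (liftedFaces p) := by
  obtain ⟨v, hv, hv_local⟩ := exists_lifted_vertex_map hK hp
  choose F hF hvF using hv_local
  intro z hz hbd
  obtain ⟨ε, hε_fill, hε⟩ := ((exists_boundary_eq_of_contractible hp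
    (fun F hF => (Finsupp.mem_supported _ _).1 hz hF) hvF).and self_mem_nhdsWithin).exists
  obtain ⟨z', hz', hbd', hvz'⟩ := exists_carried_cycle (C := fineLiftedLists p ε)
    (isLowerSet_liftedFaces p) (by simp [fineLiftedLists, fineLists])
    (fun F hF hne z => exists_boundary_eq_fineLiftedLists hp hε hF hne) v
    (fun F _ l hl => ⟨by simpa using hl.2.1, fun e he => hv F e (hl.1 e he)⟩) hz hbd
  obtain ⟨c, hc, hcz'⟩ := hε_fill z' hz' hbd'
  refine ⟨SetChain.ofList (ListChain.map v c), ?_, ?_⟩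
  · refine map_mem_of_mem_supported (SetChain.ofList ∘ₗ ListChain.map v) ?_ hc
    rintro l ⟨e', hl⟩
    rw [LinearMap.comp_apply, ListChain.map_single]
    refine Finsupp.supported_mono ?_ (SetChain.ofList_single_mem_chainsIn _)
    rintro G ⟨-, hG⟩
    refine isLowerSet_liftedFaces p (fun x hx => ?_) (hF e')
    obtain ⟨e, he, rfl⟩ := List.mem_map.1 (hG x hx)
    exact hl e he
  · rw [SetChain.boundary_ofList, ListChain.boundary_map, hcz', hvz']

end Acyclic

/-! ### Equivariant cochains -/

/-- The mod 2 coboundary of a function on simplices. -/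
def coboundary {E : Type*} [DecidableEq E] (f : Finset E → ZMod 2) (F : Finset E) : ZMod 2 :=
  ∑ x ∈ F, f (F.erase x)

section Coboundary

variable {E : Type*} [DecidableEq E]

theorem coboundary_add (f g : Finset E → ZMod 2) :
    coboundary (f + g) = coboundary f + coboundary g :=
  funext fun _ => Finset.sum_add_distrib

theorem coboundary_congr {f g : Finset E → ZMod 2} {F : Finset E}
    (h : ∀ x ∈ F, f (F.erase x) = g (F.erase x)) : coboundary f F = coboundary g F :=
  Finset.sum_congr rfl h

theorem coboundary_singleton (f : Finset E → ZMod 2) (x : E) : coboundary f {x} = f ∅ := by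
  simp [coboundary]

open scoped Pointwise in
theorem coboundary_smul {Γ : Type*} [Group Γ] [MulAction Γ E] (f : Finset E → ZMod 2) (γ : Γ)
    (F : Finset E) : coboundary f (γ • F) = coboundary (fun G => f (γ • G)) F := by
  rw [coboundary, coboundary, Finset.smul_finset_def,
    Finset.sum_image (MulAction.injective γ).injOn]
  exact Finset.sum_congr rfl fun x _ => by
    rw [Finset.smul_finset_def, Finset.image_erase (MulAction.injective γ)]

theorem linearCombination_boundary (f : Finset E → ZMod 2) (c : SetChain E) :
    Finsupp.linearCombination (ZMod 2) f (SetChain.boundary c) =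
      Finsupp.linearCombination (ZMod 2) (coboundary f) c := by
  have : Finsupp.linearCombination (ZMod 2) f ∘ₗ SetChain.boundary =
      Finsupp.linearCombination (ZMod 2) (coboundary f) := by
    ext F
    simp [SetChain.boundary_single, coboundary]
  exact LinearMap.congr_fun this c

theorem coboundary_coboundary (f : Finset E → ZMod 2) (F : Finset E) :
    coboundary (coboundary f) F = 0 := by
  have h := linearCombination_boundary f (SetChain.boundary (Finsupp.single F 1))
  rw [SetChain.boundary_boundary_single, map_zero, linearCombination_boundary] at h
  simpa using h.symm

theorem SetChain.IsAcyclic.exists_coboundary_eq {X : Set (Finset E)} (hX : SetChain.IsAcyclic X)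
    {f : Finset E → ZMod 2} (hf : ∀ F ∈ X, coboundary f F = 0) :
    ∃ g, ∀ F ∈ X, coboundary g F = f F := by
  let d : chainsIn X →ₗ[ZMod 2] SetChain E := SetChain.boundary.domRestrict (chainsIn X)
  let f' : Module.Dual (ZMod 2) (chainsIn X) :=
    (Finsupp.linearCombination (ZMod 2) f).domRestrict (chainsIn X)
  have hf' : f' ∈ (LinearMap.ker d).dualAnnihilator := by
    rw [Submodule.mem_dualAnnihilator]
    rintro ⟨z, hz⟩ hbd
    obtain ⟨c, hc, rfl⟩ := hX z hz hbd
    calc Finsupp.linearCombination (ZMod 2) f (SetChain.boundary c)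
        = Finsupp.linearCombination (ZMod 2) (coboundary f) c := linearCombination_boundary f c
      _ = (0 : SetChain E →ₗ[ZMod 2] ZMod 2) c :=
        map_eq_map_of_mem_supported (fun F hF => by simpa using hf F hF) hc
  rw [← LinearMap.range_dualMap_eq_dualAnnihilator_ker] at hf'
  obtain ⟨g, hg⟩ := hf'
  refine ⟨fun F => g (Finsupp.single F 1), fun F hF => ?_⟩
  have hgF : g (SetChain.boundary (Finsupp.single F 1)) =
      Finsupp.linearCombination (ZMod 2) f (Finsupp.single F 1) :=
    LinearMap.congr_fun hg ⟨Finsupp.single F 1, Finsupp.single_mem_supported _ _ hF⟩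
  rw [SetChain.boundary_single, map_sum] at hgF
  simpa [coboundary] using hgF

end Coboundary

theorem BernoulliShift.continuous_of_forall_finite {Γ S T : Type*}
    {f : BernoulliShift Γ S → BernoulliShift Γ T}
    (hf : ∀ γ, ∃ J : Set Γ, J.Finite ∧ ∀ τ τ' : BernoulliShift Γ S,
      (∀ j ∈ J, τ j = τ' j) → f τ γ = f τ' γ) : Continuous f := by
  let _ : TopologicalSpace S := ⊥
  have : DiscreteTopology S := ⟨rfl⟩
  let _ : TopologicalSpace T := ⊥
  refine continuous_pi (A := fun _ : Γ => T) fun γ => ?_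
  obtain ⟨J, hJ, hfJ⟩ := hf γ
  refine IsLocallyConstant.continuous ((IsLocallyConstant.iff_eventually_eq _).2 fun τ => ?_)
  have hnear : ∀ᶠ τ' : Γ → S in 𝓝 τ, ∀ j ∈ J, τ' j = τ j :=
    (Filter.eventually_all_finite hJ).2 fun j _ =>
      (continuous_apply (A := fun _ : Γ => S) j).continuousAt.eventually_mem
        (s := {τ j}) (mem_nhds_discrete.2 rfl)
  exact hnear.mono fun τ' h => hfJ τ' τ h

open scoped Pointwise in
/-- `σ` is a system of representatives for the orbits of `Γ` on the nonempty simplices of `X`, and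
`Γ` acts freely on these simplices. The inverse makes the identification of cochains with points of
a Bernoulli shift equivariant. -/
def IsOrbitTransversal (Γ : Type*) {ι E : Type*} [Group Γ] [MulAction Γ E] [DecidableEq E]
    (σ : ι → Finset E) (X : Set (Finset E)) : Prop :=
  Set.BijOn (fun q : ι × Γ => q.2⁻¹ • σ q.1) Set.univ {F ∈ X | F.Nonempty}

/-- The mod 2 cochains of degree `n`, on a complex with orbit representatives `σ`, as a Bernoulli
shift: the letter of `τ` at `γ` records the values on the simplices `γ⁻¹ • σ s`. -/
abbrev CochainShift (Γ : Type*) {ι E : Type*} (σ : ι → Finset E) (n : ℕ) : Type _ :=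
  BernoulliShift Γ ({s // (σ s).card = n + 1} → ZMod 2)

namespace CochainShift

open scoped Pointwise

variable {Γ ι E : Type*} [Group Γ] [MulAction Γ E] [DecidableEq E] {σ : ι → Finset E} {n : ℕ}

/-- A cochain as a function on all finite sets, extended by zero. -/
noncomputable def toFun (τ : CochainShift Γ σ n) : Finset E → ZMod 2 :=
  Function.extend (fun q : {s // (σ s).card = n + 1} × Γ => q.2⁻¹ • σ q.1) (fun q => τ q.2 q.1) 0

/-- The restriction of a function to the simplices of dimension `n`. -/
def ofFun (n : ℕ) (f : Finset E → ZMod 2) : CochainShift Γ σ n :=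
  fun γ s => f (γ⁻¹ • σ s)

theorem toFun_eq_zero (τ : CochainShift Γ σ n) {F : Finset E} (hF : F.card ≠ n + 1) :
    τ.toFun F = 0 := by
  refine Function.extend_apply' _ _ _ ?_
  rintro ⟨q, rfl⟩
  exact hF (by rw [Finset.card_smul_finset, q.1.2])

theorem toFun_add (τ τ' : CochainShift Γ σ n) : (τ + τ').toFun = τ.toFun + τ'.toFun := by
  simp only [toFun, ← Function.extend_add, add_zero]
  rfl

theorem toFun_zero : (0 : CochainShift Γ σ n).toFun = 0 :=
  Function.extend_zero (γ := ZMod 2) _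

variable {X : Set (Finset E)} (hσ : IsOrbitTransversal Γ σ X)

include hσ

theorem toFun_simplex (τ : CochainShift Γ σ n) (γ : Γ) (s : {s // (σ s).card = n + 1}) :
    τ.toFun (γ⁻¹ • σ s) = τ γ s := by
  refine Function.Injective.extend_apply ?_ (fun q => τ q.2 q.1) (0 : Finset E → ZMod 2) (s, γ)
  rintro ⟨s, γ⟩ ⟨s', γ'⟩ h
  have := hσ.injOn (Set.mem_univ (s.1, γ)) (Set.mem_univ (s'.1, γ')) h
  grind

theorem exists_eq_smul {F : Finset E} (hF : F ∈ X) (hcard : F.card = n + 1) :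
    ∃ (γ : Γ) (s : {s // (σ s).card = n + 1}), γ⁻¹ • σ s = F := by
  obtain ⟨⟨s, γ⟩, -, rfl⟩ := hσ.surjOn ⟨hF, Finset.card_pos.1 (by omega)⟩
  exact ⟨γ, ⟨s, by simpa [Finset.card_smul_finset] using hcard⟩, rfl⟩

theorem smul_mem (γ : Γ) (s : ι) : γ⁻¹ • σ s ∈ X :=
  (hσ.mapsTo (Set.mem_univ (s, γ))).1

theorem toFun_ofFun {f : Finset E → ZMod 2} {F : Finset E} (hF : F ∈ X)
    (hf : F.card ≠ n + 1 → f F = 0) : (ofFun n f : CochainShift Γ σ n).toFun F = f F := by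
  by_cases hcard : F.card = n + 1
  · obtain ⟨γ, s, rfl⟩ := exists_eq_smul hσ hF hcard
    exact toFun_simplex hσ _ γ s
  · rw [hf hcard, toFun_eq_zero _ hcard]

theorem toFun_smul (γ : Γ) (τ : CochainShift Γ σ n) {F : Finset E} (hF : F ∈ X) :
    (γ • τ).toFun F = τ.toFun (γ⁻¹ • F) := by
  by_cases hcard : F.card = n + 1
  · obtain ⟨δ, s, rfl⟩ := exists_eq_smul hσ hF hcard
    rw [smul_smul, ← mul_inv_rev, toFun_simplex hσ, toFun_simplex hσ, BernoulliShift.smul_apply]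
  · rw [toFun_eq_zero _ hcard, toFun_eq_zero _ (by rwa [Finset.card_smul_finset])]

omit hσ in
/-- The coboundary operator on cochains of degree `n`. -/
noncomputable def diff (Γ : Type*) [Group Γ] [MulAction Γ E] (σ : ι → Finset E) (n : ℕ) :
    CochainShift Γ σ n →+ CochainShift Γ σ (n + 1) :=
  AddMonoidHom.mk' (fun τ => ofFun (n + 1) (coboundary τ.toFun)) fun τ τ' => by
    rw [toFun_add, coboundary_add]
    rfl

theorem toFun_diff (τ : CochainShift Γ σ n) {F : Finset E} (hF : F ∈ X) :
    (diff Γ σ n τ).toFun F = coboundary τ.toFun F := by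
  refine toFun_ofFun hσ (f := coboundary τ.toFun) hF fun hcard =>
    Finset.sum_eq_zero fun x hx => toFun_eq_zero _ ?_
  have := Finset.card_erase_add_one hx
  omega

theorem exists_coboundary_eq_of_diff_eq_zero (hX_acyclic : SetChain.IsAcyclic X)
    {τ : CochainShift Γ σ n} (hτ : diff Γ σ n τ = 0) :
    ∃ g, ∀ γ s, τ γ s = coboundary g (γ⁻¹ • σ s) := by
  obtain ⟨g, hg⟩ := hX_acyclic.exists_coboundary_eq (f := τ.toFun) fun F hF => by
    rw [← toFun_diff hσ τ hF, hτ]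
    exact congrFun toFun_zero F
  exact ⟨g, fun γ s => by rw [hg _ (smul_mem hσ γ s), toFun_simplex hσ]⟩

theorem finite_ker_diff_zero (hX_acyclic : SetChain.IsAcyclic X) :
    Finite (diff Γ σ 0).ker := by
  refine Set.Finite.to_subtype ((Set.finite_range fun (r : ZMod 2) (_ : Γ)
    (_ : {s // (σ s).card = 0 + 1}) => r).subset fun τ hτ => ?_)
  obtain ⟨g, hg⟩ := exists_coboundary_eq_of_diff_eq_zero hσ hX_acyclic hτ
  refine ⟨g ∅, funext fun γ => funext fun s => ?_⟩
  obtain ⟨x, hx⟩ := Finset.card_eq_one.1 ((Finset.card_smul_finset γ⁻¹ (σ s)).trans s.2)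
  rw [hg, hx, coboundary_singleton]

variable (hX : IsLowerSet X)

include hX

theorem continuous_diff [Finite ι] : Continuous (diff Γ σ n) := by
  refine BernoulliShift.continuous_of_forall_finite fun γ => ?_
  let facets : Set (Finset E) := ⋃ s, (γ⁻¹ • σ s).erase '' (γ⁻¹ • σ s : Finset E)
  have hfacets : facets.Finite := Set.finite_iUnion fun s => (Finset.finite_toSet _).image _
  refine ⟨Prod.snd '' ((fun q : ι × Γ => q.2⁻¹ • σ q.1) ⁻¹' facets),
    (hfacets.preimage (hσ.injOn.mono (Set.subset_univ _))).image _, fun τ τ' h => ?_⟩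
  refine funext fun s => coboundary_congr fun x hx => ?_
  have hfacet : (γ⁻¹ • σ s).erase x ∈ facets := Set.mem_iUnion.2 ⟨s, x, hx, rfl⟩
  obtain ⟨δ, t, hδt⟩ := exists_eq_smul (n := n) hσ
    (hX (Finset.erase_subset x _) (smul_mem hσ γ s))
    (by rw [Finset.card_erase_of_mem hx, Finset.card_smul_finset, s.2, Nat.add_sub_cancel])
  rw [← hδt, toFun_simplex hσ, toFun_simplex hσ]
  exact congrFun (h δ ⟨(t, δ), by rwa [Set.mem_preimage, hδt], rfl⟩) t

theorem diff_smul (γ : Γ) (τ : CochainShift Γ σ n) : diff Γ σ n (γ • τ) = γ • diff Γ σ n τ := by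
  funext δ s
  calc coboundary (γ • τ).toFun (δ⁻¹ • σ s)
      = coboundary (fun G => τ.toFun (γ⁻¹ • G)) (δ⁻¹ • σ s) := coboundary_congr fun x _ =>
        toFun_smul hσ γ τ (hX (Finset.erase_subset x _) (smul_mem hσ δ s))
    _ = coboundary τ.toFun ((δ * γ)⁻¹ • σ s) := by
      rw [← coboundary_smul, smul_smul, mul_inv_rev]

theorem diff_diff (τ : CochainShift Γ σ n) : diff Γ σ (n + 1) (diff Γ σ n τ) = 0 := by
  funext γ s
  calc coboundary (diff Γ σ n τ).toFun (γ⁻¹ • σ s)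
      = coboundary (coboundary τ.toFun) (γ⁻¹ • σ s) := coboundary_congr fun x _ =>
        toFun_diff hσ τ (hX (Finset.erase_subset x _) (smul_mem hσ γ s))
    _ = 0 := coboundary_coboundary _ _

theorem range_diff_eq_ker_diff (hX_acyclic : SetChain.IsAcyclic X) :
    (diff Γ σ n).range = (diff Γ σ (n + 1)).ker := by
  ext τ
  refine ⟨by rintro ⟨τ, rfl⟩; exact diff_diff hσ hX τ, fun hτ => ?_⟩
  obtain ⟨g, hg⟩ := exists_coboundary_eq_of_diff_eq_zero hσ hX_acyclic hτ
  refine ⟨ofFun n g, funext fun γ => funext fun s => ?_⟩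
  rw [hg]
  refine coboundary_congr fun x hx => toFun_ofFun hσ (hX (Finset.erase_subset x _)
    (smul_mem hσ γ s)) fun hcard => (hcard ?_).elim
  rw [Finset.card_erase_of_mem hx, Finset.card_smul_finset, s.2, Nat.add_sub_cancel]

end CochainShift

/-! ### Entropy of cocycles -/

theorem LinearSubshift.toAddSubgroup_injective {Γ S : Type*} [Monoid Γ] [AddCommGroup S] :
    Function.Injective (LinearSubshift.toAddSubgroup : LinearSubshift Γ S → _) := by
  rintro ⟨A, _, _⟩ ⟨B, _, _⟩ (rfl : A = B)
  rfl

/-- The kernel of a continuous equivariant homomorphism between full Bernoulli shifts, which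
avoids passing through the points of `LinearSubshift.full`. -/
def LinearSubshift.ofKer {Γ S T : Type*} [Monoid Γ] [AddCommGroup S] [AddCommGroup T]
    (D : BernoulliShift Γ S →+ BernoulliShift Γ T) (hD : Continuous D)
    (hequiv : ∀ (γ : Γ) τ, D (γ • τ) = γ • D τ) : LinearSubshift Γ S where
  toAddSubgroup := D.ker
  isClosed := isClosed_singleton.preimage hD
  smul_mem γ τ hτ := by
    rw [AddMonoidHom.mem_ker] at hτ ⊢
    rw [hequiv, hτ, BernoulliShift.smul_zero]

/-- A real-valued function on linear subshifts satisfying the axioms (A2), (A5) and (A6). -/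
structure YuzvinskiiEntropy (Γ : Type*) [Monoid Γ] where
  /-- the entropy function -/
  h : ∀ {S : Type} [AddCommGroup S] [Finite S], LinearSubshift Γ S → ℝ
  h_full : ∀ (S : Type) [AddCommGroup S] [Finite S],
    h (LinearSubshift.full Γ S) = Real.logb 2 (Nat.card S)
  h_finite : ∀ {S : Type} [AddCommGroup S] [Finite S] (φ : LinearSubshift Γ S),
    Finite φ.Points → h φ = 0
  h_add : ∀ {S₁ S₂ : Type} [AddCommGroup S₁] [Finite S₁] [AddCommGroup S₂] [Finite S₂]
    (φ₁ : LinearSubshift Γ S₁) (φ₂ : LinearSubshift Γ S₂) (T : φ₁.Points →+ φ₂.Points)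
    (hT : Continuous T) (hequiv : ∀ (γ : Γ) (τ : φ₁.Points), T (γ • τ) = γ • T τ),
    Function.Surjective T → h (LinearSubshift.ker T hT hequiv) + h φ₂ = h φ₁

/-- Forget the axioms (A3) and (A4). -/
def AdditiveEntropy.toYuzvinskiiEntropy {Γ : Type*} [Monoid Γ] (H : AdditiveEntropy Γ) :
    YuzvinskiiEntropy Γ where
  h := H.h
  h_full := H.h_full
  h_finite := H.h_finite
  h_add := H.h_add

theorem YuzvinskiiEntropy.h_ofKer_add {Γ : Type*} [Monoid Γ] (H : YuzvinskiiEntropy Γ)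
    {S T : Type} [AddCommGroup S] [Finite S] [AddCommGroup T] [Finite T]
    {D : BernoulliShift Γ S →+ BernoulliShift Γ T} (hD : Continuous D)
    (hequiv : ∀ (γ : Γ) τ, D (γ • τ) = γ • D τ) {φ : LinearSubshift Γ T}
    (hφ : D.range = φ.toAddSubgroup) :
    H.h (LinearSubshift.ofKer D hD hequiv) + H.h φ = Real.logb 2 (Nat.card S) := by
  have hmem : ∀ τ, D τ ∈ φ.toAddSubgroup := fun τ => hφ ▸ ⟨τ, rfl⟩
  let D' : (LinearSubshift.full Γ S).Points →+ φ.Points :=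
    (D.codRestrict φ.toAddSubgroup hmem).comp (AddSubgroup.subtype _)
  have hD' : Continuous D' := (hD.comp continuous_subtype_val).subtype_mk _
  have hD'_equiv : ∀ (γ : Γ) τ, D' (γ • τ) = γ • D' τ := fun γ τ => Subtype.ext (hequiv γ τ)
  have hD'_surj : Function.Surjective D' := fun ⟨τ, hτ⟩ => by
    obtain ⟨τ', rfl⟩ := hφ ▸ hτ
    exact ⟨⟨τ', trivial⟩, rfl⟩
  have hker : LinearSubshift.ker D' hD' hD'_equiv = LinearSubshift.ofKer D hD hequiv := by
    refine LinearSubshift.toAddSubgroup_injective (AddSubgroup.ext fun τ => ⟨?_, fun hτ => ?_⟩)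
    · rintro ⟨τ, hτ, rfl⟩
      exact congrArg Subtype.val hτ
    · exact ⟨⟨τ, trivial⟩, Subtype.ext hτ, rfl⟩
  rw [← hker, H.h_add _ _ _ _ _ hD'_surj, H.h_full]

namespace CochainShift

variable {Γ E : Type*} {ι : Type} [Group Γ] [MulAction Γ E] [DecidableEq E] [Fintype ι]
variable {σ : ι → Finset E} {X : Set (Finset E)}

/-- The linear subshift of cocycles of degree `n`. -/
noncomputable def cocycles (hσ : IsOrbitTransversal Γ σ X) (hX : IsLowerSet X) (n : ℕ) :
    LinearSubshift Γ ({s // (σ s).card = n + 1} → ZMod 2) :=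
  LinearSubshift.ofKer (diff Γ σ n) (continuous_diff hσ hX) (diff_smul hσ hX)

variable (hσ : IsOrbitTransversal Γ σ X) (hX : IsLowerSet X) (H : YuzvinskiiEntropy Γ)

theorem h_cocycles_zero (hX_acyclic : SetChain.IsAcyclic X) : H.h (cocycles hσ hX 0) = 0 :=
  H.h_finite _ (finite_ker_diff_zero hσ hX_acyclic)

theorem h_cocycles_of_forall_card_le {n : ℕ} (hn : ∀ s, (σ s).card ≤ n) :
    H.h (cocycles hσ hX n) = 0 := by
  have : IsEmpty {s // (σ s).card = n + 1} := ⟨fun s => by have := hn s; have := s.2; omega⟩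
  have : Subsingleton (CochainShift Γ σ n) :=
    inferInstanceAs (Subsingleton (Γ → {s // (σ s).card = n + 1} → ZMod 2))
  exact H.h_finite _ inferInstance

theorem h_cocycles_add_h_cocycles (hX_acyclic : SetChain.IsAcyclic X) (n : ℕ) :
    H.h (cocycles hσ hX n) + H.h (cocycles hσ hX (n + 1)) =
      (Finset.univ.filter fun s => (σ s).card = n + 1).card := by
  rw [cocycles, H.h_ofKer_add _ _ (range_diff_eq_ker_diff hσ hX hX_acyclic), Nat.card_fun,
    Nat.card_zmod, Nat.card_eq_fintype_card, Fintype.card_subtype, Nat.cast_pow, Real.logb_pow]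
  simp

include hσ hX H

/-- The entropies of the cocycles telescope. -/
theorem sum_neg_one_pow_card_sub_one_eq_zero (hX_acyclic : SetChain.IsAcyclic X) :
    ∑ s, (-1 : ℤ) ^ ((σ s).card - 1) = 0 := by
  obtain ⟨N, hN⟩ : ∃ N, ∀ s, (σ s).card ≤ N :=
    ⟨_, fun s => Finset.le_sup (f := fun s => (σ s).card) (Finset.mem_univ s)⟩
  have hpos : ∀ s, 0 < (σ s).card := fun s => by
    simpa [Finset.card_pos] using (hσ.mapsTo (Set.mem_univ (s, (1 : Γ)))).2
  have hmaps : ∀ s ∈ Finset.univ, (σ s).card - 1 ∈ Finset.range N := fun s _ =>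
    Finset.mem_range.2 (by have := hN s; have := hpos s; omega)
  have hfiber : ∀ n s, (σ s).card - 1 = n ↔ (σ s).card = n + 1 := fun n s => by
    have := hpos s
    omega
  suffices h : ((∑ s, (-1 : ℤ) ^ ((σ s).card - 1) : ℤ) : ℝ) = 0 by exact_mod_cast h
  calc ((∑ s, (-1 : ℤ) ^ ((σ s).card - 1) : ℤ) : ℝ)
      = ∑ n ∈ Finset.range N, (-1) ^ n * ((Finset.univ.filter fun s =>
          (σ s).card = n + 1).card : ℝ) := by
        push_cast
        rw [← Finset.sum_fiberwise_of_maps_to hmaps]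
        refine Finset.sum_congr rfl fun n _ => ?_
        rw [Finset.sum_congr rfl fun s hs => by rw [(Finset.mem_filter.1 hs).2], Finset.sum_const,
          nsmul_eq_mul, mul_comm, Finset.filter_congr fun s _ => hfiber n s]
    _ = ∑ n ∈ Finset.range N, ((-1) ^ n * H.h (cocycles hσ hX n) -
          (-1) ^ (n + 1) * H.h (cocycles hσ hX (n + 1))) := by
        refine Finset.sum_congr rfl fun n _ => ?_
        rw [← h_cocycles_add_h_cocycles hσ hX H hX_acyclic]
        ring
    _ = 0 := by
        rw [Finset.sum_range_sub', h_cocycles_zero hσ hX H hX_acyclic,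
          h_cocycles_of_forall_card_le hσ hX H hN]
        simp

end CochainShift

/-! ### The Euler characteristic of the base -/

section Orbits

open scoped Pointwise

theorem smul_finset_image {Γ α β : Type*} [SMul Γ β] [DecidableEq β] (γ : Γ) (s : Finset α)
    (f : α → β) : γ • s.image f = s.image fun x => γ • f x := by
  rw [Finset.smul_finset_def, Finset.image_image]
  rfl

variable {V : Type*} [NormedAddCommGroup V] [NormedSpace ℝ V] {K : Geometry.SimplicialComplex ℝ V}
variable {Γ E : Type*} [Group Γ] [MulAction Γ E] [TopologicalSpace E] {p : E → K.space}

theorem exists_isSimplexLift_of_isQuotientCoveringMap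
    (hp : IsQuotientCoveringMap p Γ) (s : K.faces) : ∃ ℓ, IsSimplexLift p (s : Finset V) ℓ := by
  obtain ⟨x, hx⟩ := K.nonempty_of_mem_faces s.2
  obtain ⟨e, he⟩ := hp.surjective ⟨x, K.subset_space s.2 hx⟩
  have hes : (p e : V) ∈ convexHull ℝ (s : Set V) := by
    rw [he]
    exact mem_convexHull_of_mem hx
  obtain ⟨ℓ, hℓ, -⟩ := exists_isSimplexLift hp.isCoveringMap s.2 hes
  exact ⟨ℓ, hℓ⟩

variable [DecidableEq E] {s : Finset V} {ℓ ℓ' : V → E}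

namespace IsSimplexLift

theorem exists_smul_image_eq (hp : IsQuotientCoveringMap p Γ) (hℓ : IsSimplexLift p s ℓ)
    (hℓ' : IsSimplexLift p s ℓ') (hs : s.Nonempty) : ∃ γ : Γ, γ • s.image ℓ = s.image ℓ' := by
  obtain ⟨x, hx⟩ := hs
  have hx := mem_convexHull_of_mem hx
  have hpx : p (ℓ' x) = p (ℓ x) :=
    Subtype.ext ((hℓ'.apply_eq x hx).trans (hℓ.apply_eq x hx).symm)
  obtain ⟨γ, hγ⟩ := hp.apply_eq_iff_mem_orbit.1 hpx
  refine ⟨γ, (smul_finset_image γ s ℓ).trans (Finset.image_congr fun y hy => ?_)⟩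
  have hy := mem_convexHull_of_mem (Finset.mem_coe.1 hy)
  exact (hℓ.smul hp γ).eq_of_eq hp.isCoveringMap hℓ' hx hx hγ hy hy

theorem eq_of_smul_image_eq (hp : IsQuotientCoveringMap p Γ) (hℓ : IsSimplexLift p s ℓ)
    (hs : s.Nonempty) {γ γ' : Γ} (h : γ • s.image ℓ = γ' • s.image ℓ) : γ = γ' := by
  obtain ⟨x, hx⟩ := hs
  rw [smul_finset_image, smul_finset_image] at h
  have := hp.isCancelSMul
  exact IsCancelSMul.right_cancel _ _ _
    ((hℓ.smul hp γ).mem_of_image_subset (hℓ.smul hp γ') h.subset hx).2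

end IsSimplexLift

theorem exists_isOrbitTransversal_liftedFaces (hp : IsQuotientCoveringMap p Γ) :
    ∃ σ : K.faces → Finset E, IsOrbitTransversal Γ σ (liftedFaces p) ∧
      ∀ s, (σ s).card = (s : Finset V).card := by
  choose ℓ hℓ using fun s : K.faces => exists_isSimplexLift_of_isQuotientCoveringMap hp s
  have hne (s : K.faces) := K.nonempty_of_mem_faces s.2
  refine ⟨fun s => (s : Finset V).image (ℓ s), ⟨?_, ?_, ?_⟩, fun s =>
    Finset.card_image_of_injOn ((hℓ s).injOn.mono (subset_convexHull ℝ _))⟩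
  · rintro ⟨s, γ⟩ -
    exact ⟨⟨s, _, (hℓ s).smul hp γ⁻¹, (smul_finset_image _ _ _).symm⟩,
      ((hne s).image _).smul_finset⟩
  · rintro ⟨s, γ⟩ - ⟨s', γ'⟩ - (h : γ⁻¹ • _ = γ'⁻¹ • _)
    obtain rfl : s = s' := Subtype.ext <| ((hℓ s).smul hp γ⁻¹).eq_of_image_eq
      ((hℓ s').smul hp γ'⁻¹) (by rwa [← smul_finset_image, ← smul_finset_image])
    rw [inv_injective ((hℓ s).eq_of_smul_image_eq hp (hne s) h)]
  · rintro F ⟨⟨s, m, hm, rfl⟩, hs⟩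
    have hs := Finset.image_nonempty.1 hs
    let t : K.faces := ⟨s, hm.mem_faces hs⟩
    obtain ⟨γ, hγ⟩ := (hℓ t).exists_smul_image_eq hp hm hs
    exact ⟨(t, γ⁻¹), Set.mem_univ _, by simpa using hγ⟩

end Orbits

theorem mainTheorem1_general {Γ : Type*} [Group Γ] (BΓ : FiniteClassifyingComplex Γ)
    (H : YuzvinskiiEntropy Γ) : BΓ.eulerChar = 0 := by
  classical
  obtain ⟨E, _, _, p, _, hp⟩ := BΓ.exists_contractible_cover
  obtain ⟨σ, hσ, hcard⟩ := exists_isOrbitTransversal_liftedFaces hp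
  have := BΓ.finite_faces.fintype
  have h := CochainShift.sum_neg_one_pow_card_sub_one_eq_zero hσ (isLowerSet_liftedFaces p) H
    (isAcyclic_liftedFaces BΓ.finite_faces hp.isCoveringMap)
  simp only [hcard] at h
  rw [FiniteClassifyingComplex.eulerChar, ← h]
  exact Finset.sum_subtype _ (fun s => BΓ.finite_faces.mem_toFinset) _

/-- If `Γ` is a group of finite type, `BΓ` a finite simplicial classifying space of it, and
`e(Γ) = χ(BΓ)` is nonzero, then `Γ` is not symbolically entropy additive. -/
theorem mainTheorem1 {Γ : Type*} [Group Γ] (BΓ : FiniteClassifyingComplex Γ)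
    (he : BΓ.eulerChar ≠ 0) : ¬ IsSEA Γ :=
  fun ⟨H⟩ => he (mainTheorem1_general BΓ H.toYuzvinskiiEntropy)
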